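/- Let $n\ge 1$, let $S^{2n+1}\subset\mathbb{C}^{n+1}$ be the unit sphere with the contact form $\theta_0=\frac i2\sum_{j}(z_j\,d\bar z_j-\bar z_j\,dz_j)$, the volume $dV=\theta_0\wedge(d\theta_0)^n$ and the total volume $\omega_{2n+1}=\int_{S^{2n+1}}dV$. Let $Q=2n+2$, $s\in(0,1)$, $1<p<Q$ and $p^*=\frac{Qp}{Q-sp}$. Let $d$ be a CR distance on $S^{2n+1}$, that is, a distance function on $S^{2n+1}$ with $c\,|1-\zeta\cdot\bar\eta|^{1/2}\le d(\zeta,\eta)\le C\,|1-\zeta\cdot\bar\eta|^{1/2}$ for some constants $c,C>0$ and all $\zeta,\eta\in S^{2n+1}$ (for example $|1-\zeta\cdot\bar\eta|^{1/2}$ itself, or the Carnot–Carathéodory distance of $\theta_0$). For measurable $u:S^{2n+1}\to\mathbb{R}$ put $$[u]_{s,p}^p=\int_{S^{2n+1}}\int_{S^{2n+1}}\frac{|u(\xi)-u(\eta)|^p}{d(\xi,\eta)^{Q+sp}}\,dV(\xi)\,dV(\eta),\qquad HW^{s,p}(S^{2n+1})=\{u\in L^p(S^{2n+1}):[u]_{s,p}<\infty\},$$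 and let $\widehat{\mathbb{B}}_p$ be the set of all $B\in\mathbb{R}$ for which there is an $A\in\mathbb{R}$ such that $$\|u\|_{L^{p^*}(S^{2n+1})}^p\le A\,[u]_{s,p}^p+B\,\|u\|_{L^p(S^{2n+1})}^p\qquad\text{for all }u\in HW^{s,p}(S^{2n+1})$$ (in particular, $u\in L^{p^*}(S^{2n+1})$ for all these $u$). (i) If $1<p\le 2$, then $\widehat{\mathbb{B}}_p=[\omega_{2n+1}^{-sp/Q},\infty)$. In particular, $\widehat{\mathbb{B}}_p$ is closed and its left endpoint is attained. (ii) If $2<p<Q$, then $\widehat{\mathbb{B}}_p=(\omega_{2n+1}^{-sp/Q},\infty)$. Hence $\omega_{2n+1}^{-sp/Q}$ is the optimal threshold (the infimum of $\widehat{\mathbb{B}}_p$), but it is not admissible; in particular, $\widehat{\mathbb{B}}_p$ is not closed. -/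

import Mathlib

open MeasureTheory Metric
open scoped ENNReal

noncomputable section

namespace CRSphere

/-- The ambient space `ℂⁿ⁺¹` (with its Hermitian norm; as a real inner product space its inner
product is the real part of the Hermitian one). -/
abbrev Amb (n : ℕ) : Type := EuclideanSpace ℂ (Fin (n + 1))

/-- The unit sphere `S²ⁿ⁺¹ ⊂ ℂⁿ⁺¹`. -/
abbrev Sph (n : ℕ) : Type := sphere (0 : Amb n) 1

/-- The `1`-form `θ₀ = (i/2) ∑ⱼ (zⱼ dz̄ⱼ - z̄ⱼ dzⱼ) = ∑ⱼ (xⱼ dyⱼ - yⱼ dxⱼ)` on `ℂⁿ⁺¹`: its value at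
the point `z` on the vector `v` is `Im ∑ⱼ z̄ⱼ vⱼ`. -/
def contactForm (n : ℕ) (z : Amb n) : Amb n [⋀^Fin 1]→L[ℝ] ℝ :=
  ContinuousAlternatingMap.ofSubsingleton ℝ (Amb n) ℝ 0
    (Complex.imCLM.comp ((innerSL ℂ z).restrictScalars ℝ))

/-- The exterior (wedge) product of alternating forms (the sum over shuffles, with signs). -/
def wedge {E : Type*} [AddCommGroup E] [Module ℝ E] {k l : ℕ}
    (α : E [⋀^Fin k]→ₗ[ℝ] ℝ) (β : E [⋀^Fin l]→ₗ[ℝ] ℝ) : E [⋀^Fin (k + l)]→ₗ[ℝ] ℝ :=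
  (LinearMap.mul' ℝ ℝ).compAlternatingMap ((α.domCoprod β).domDomCongr finSumFinEquiv)

/-- The `(2k+1)`-form `θ₀ ∧ (dθ₀)ᵏ` at the point `z`. -/
def contactWedge (n : ℕ) (z : Amb n) : (k : ℕ) → Amb n [⋀^Fin (2 * k + 1)]→ₗ[ℝ] ℝ
  | 0 => (contactForm n z).toAlternatingMap
  | k + 1 => wedge (k := 2 * k + 1) (contactWedge n z k) (extDeriv (contactForm n) z).toAlternatingMap

/-- The absolute value of the top-degree form `θ₀ ∧ (dθ₀)ⁿ` on the orthonormal bases of the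
tangent space `T_ζ S²ⁿ⁺¹ = {v | Re ⟨ζ, v⟩ = 0}`. This value does not depend on the basis, so the
supremum is just a way to write it without a choice. -/
def volumeDensity (n : ℕ) (ζ : Sph n) : ℝ≥0∞ :=
  ⨆ (v : Fin (2 * n + 1) → Amb n) (_ : Orthonormal ℝ v) (_ : ∀ i, inner ℝ (ζ : Amb n) (v i) = 0),
    ‖contactWedge n ζ n v‖ₑ

/-- The measure `dV_{θ₀} = θ₀ ∧ (dθ₀)ⁿ` on `S²ⁿ⁺¹`: the measure of a volume form, that is, the
Riemannian surface measure times the density of the form with respect to it. -/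
def vol (n : ℕ) : Measure (Sph n) :=
  ((volume : Measure (Amb n)).toSphere).withDensity (volumeDensity n)

/-- The total volume `ω_{2n+1}` of `S²ⁿ⁺¹`. -/
def omega (n : ℕ) : ℝ := (vol n).real Set.univ

/-- The homogeneous dimension `Q = 2n + 2`. -/
def homDim (n : ℕ) : ℝ := 2 * n + 2

/-- The critical exponent `p* = Q p / (Q - s p)`. -/
def critExp (n : ℕ) (s p : ℝ) : ℝ := homDim n * p / (homDim n - s * p)

/-- The Korányi-type gauge `|1 - ⟨ζ, η⟩|^{1/2}` of the CR sphere. On the sphere,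
`1 - Re ⟨ζ, η⟩ = |η - ζ|² / 2` and `Im ⟨ζ, η⟩ = θ₀|_ζ(η - ζ)`, so that its fourth power is
`|η - ζ|⁴ / 4 + (θ₀|_ζ(η - ζ))²`. -/
def gauge (n : ℕ) (ζ η : Sph n) : ℝ := Real.sqrt ‖1 - inner ℂ (ζ : Amb n) (η : Amb n)‖

/-- A CR distance on `S²ⁿ⁺¹`: a distance function that is equivalent (two-sidedly comparable) to
the standard one, `|1 - ⟨ζ, η⟩|^{1/2}`; the Carnot–Carathéodory distance of `θ₀` is another. -/
structure IsCRDistance (n : ℕ) (d : Sph n → Sph n → ℝ) : Prop where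
  eq_zero_iff : ∀ ζ η, d ζ η = 0 ↔ ζ = η
  symm : ∀ ζ η, d ζ η = d η ζ
  triangle : ∀ ζ η ξ, d ζ ξ ≤ d ζ η + d η ξ
  equivalent : ∃ c C : ℝ, 0 < c ∧ 0 < C ∧ ∀ ζ η, c * gauge n ζ η ≤ d ζ η ∧ d ζ η ≤ C * gauge n ζ η

/-- The power `[u]_{s,p}^p` of the fractional seminorm, with values in `[0, ∞]`. -/
def seminormPow (n : ℕ) (d : Sph n → Sph n → ℝ) (s p : ℝ) (u : Sph n → ℝ) : ℝ≥0∞ :=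
  ∫⁻ ξ, ∫⁻ η, ENNReal.ofReal (|u ξ - u η| ^ p / d ξ η ^ (homDim n + s * p)) ∂(vol n) ∂(vol n)

/-- The fractional Folland–Stein space `HW^{s,p}(S²ⁿ⁺¹)`, as a set of functions. -/
def HW (n : ℕ) (d : Sph n → Sph n → ℝ) (s p : ℝ) : Set (Sph n → ℝ) :=
  {u | MemLp u (ENNReal.ofReal p) (vol n) ∧ seminormPow n d s p u < ∞}

/-- The norm `‖u‖_{L^r(S²ⁿ⁺¹)}` of a function in `L^r`, as a real number. -/
def lpNorm (n : ℕ) (r : ℝ) (u : Sph n → ℝ) : ℝ := (eLpNorm u (ENNReal.ofReal r) (vol n)).toReal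

/-- The set of `B ∈ ℝ` for which there is an `A ∈ ℝ` such that every `u ∈ HW^{s,p}` is in `L^{p*}`
and satisfies `‖u‖_{p*}^p ≤ A [u]_{s,p}^p + B ‖u‖_p^p`. -/
def admissibleBhat (n : ℕ) (d : Sph n → Sph n → ℝ) (s p : ℝ) : Set ℝ :=
  {B | ∃ A : ℝ, ∀ u ∈ HW n d s p,
    MemLp u (ENNReal.ofReal (critExp n s p)) (vol n) ∧
    lpNorm n (critExp n s p) u ^ p ≤ A * (seminormPow n d s p u).toReal + B * lpNorm n p u ^ p}

end CRSphere

end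

/-!
# The sharp lower order constant in the fractional Sobolev inequality on the CR sphere

The analytic part is carried out for a finite measure and a kernel whose balls have measure at
least `c r ^ Q` (`LowerRegular`). The volume of the CR sphere satisfies this, with a matching upper
bound, because its density is bounded above and below and gauge balls are comparable to boxes.
-/

namespace CRSphere

open Filter Topology
open scoped Pointwise

noncomputable section

/-! Put `κ = Q / (Q - s p)`, so that `p* = κ p` and `s p = Q (1 - 1/κ)`, and let `W` be the total
volume; the threshold is `W ^ (1/κ - 1)`. Constants have zero energy, so testing with `1` shows that
no smaller `B` is admissible (`Admissible.le`).

For the positive results `u` is split into its mean `a` and its oscillation `u - a`. A fractional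
Sobolev–Poincaré inequality (`sobolev_poincare`) bounds the `L^{p*}` norm of the oscillation by the
energy, and Jensen gives `|a|ᵖ ≤ W⁻¹ ∫ |u|ᵖ`. What matters is how the two parts recombine. If `p ≤
2`, the first order expansion of `|a + t|^{p*}` has a linear term, which integrates to zero, and a
remainder that costs only energy, so the coefficient of `|a|ᵖ` stays sharp
(`rpow_integral_le_of_le_two`). For arbitrary `p`, the triangle inequality and convexity lose a
factor arbitrarily close to `1`, which a `B` strictly above the threshold can afford
(`admissible_of_lt`).

If `p > 2`, equality fails at second order around constants. For `φ` bounded, nonconstant, of mean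
zero and of finite energy, `u = (1 + ε φ)^{1/p}` has `∫ uᵖ = W` exactly. Its `L^{p*}` norm gains a
term of order `ε²`, while its energy is only `O(εᵖ)` (`exists_violation`).

The Sobolev inequality needs only the lower volume bound for balls: a bound for `|u(x)|ᵖ` at every
scale is optimised in the scale (`sobolev_pointwise`), integrated, and the power of the norm on the
right is absorbed. The upper volume bound serves only to give the Lipschitz test function `Re ζ₀`
finite energy. Both come from comparing gauge balls with anisotropic boxes and from bounding the
density of `θ₀ ∧ (dθ₀)ⁿ` between positive constants. -/

/-! ### Optimisation in the scale and absorption -/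

/-- The real optimisation behind the fractional Sobolev inequality. -/
lemma rpow_le_of_forall_scale {κ D τ₀ : ℝ} (hκ : 1 < κ) (hD : 0 ≤ D) (hτ₀ : 0 < τ₀) :
    ∃ C : ℝ, 0 < C ∧ ∀ U g M T : ℝ, 0 ≤ U → 0 ≤ g → 0 ≤ M → 0 < T →
      (∀ τ, 0 < τ → τ ≤ τ₀ → U ≤ D * (τ ^ (1 - 1 / κ) * g + τ ^ (-(1 / κ)) * T)) →
      U ≤ D * (g + M) → U ^ κ ≤ C * (g * T ^ (κ - 1) + M ^ κ) := by
  have hκ0 : 0 < κ := by linarith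
  refine ⟨(2 * D + 1) ^ κ * (1 + (1 / τ₀) ^ (κ - 1)), by positivity, ?_⟩
  intro U g M T hU hg hM hT h1 h2
  have hMκ : 0 ≤ M ^ κ := by positivity
  have hgT : 0 ≤ g * T ^ (κ - 1) := by positivity
  have hτκ : 0 ≤ (1 / τ₀) ^ (κ - 1) := by positivity
  have hDκ : 0 ≤ (2 * D + 1) ^ κ := by positivity
  -- The two terms balance at `τ = T / g`. When this exceeds `τ₀`, the scale-free bound is used
  -- instead, and `g ≤ T / τ₀` turns `g ^ κ` into a multiple of `g * T ^ (κ - 1)`.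
  by_cases hcase : g * τ₀ ≤ T
  · have hm : U ≤ (2 * D + 1) * max g M := by
      have := le_max_left g M
      have := le_max_right g M
      nlinarith
    have hg' : g ^ κ ≤ (1 / τ₀) ^ (κ - 1) * (g * T ^ (κ - 1)) := by
      rcases hg.eq_or_lt with h0 | h0
      · rw [← h0, Real.zero_rpow hκ0.ne']; simp
      · have : g ^ κ = g * g ^ (κ - 1) := by
          rw [← Real.rpow_one_add' hg (by linarith)]; ring_nf
        rw [this]
        have h3 : g ≤ 1 / τ₀ * T := by
          rw [div_mul_eq_mul_div, one_mul, le_div_iff₀ hτ₀]; exact hcase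
        have h4 : g ^ (κ - 1) ≤ (1 / τ₀ * T) ^ (κ - 1) :=
          Real.rpow_le_rpow hg h3 (by linarith)
        rw [Real.mul_rpow (by positivity) hT.le] at h4
        calc g * g ^ (κ - 1) ≤ g * ((1 / τ₀) ^ (κ - 1) * T ^ (κ - 1)) := by gcongr
          _ = _ := by ring
    have hmax : (max g M) ^ κ ≤ g ^ κ + M ^ κ := by
      rcases max_cases g M with ⟨h, _⟩ | ⟨h, _⟩ <;> rw [h]
      · linarith
      · have : 0 ≤ g ^ κ := by positivity
        linarith
    calc U ^ κ ≤ ((2 * D + 1) * max g M) ^ κ := Real.rpow_le_rpow hU hm hκ0.le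
      _ = (2 * D + 1) ^ κ * (max g M) ^ κ := Real.mul_rpow (by positivity) (by positivity)
      _ ≤ (2 * D + 1) ^ κ * ((1 / τ₀) ^ (κ - 1) * (g * T ^ (κ - 1)) + M ^ κ) := by
          gcongr; linarith
      _ ≤ (2 * D + 1) ^ κ * ((1 + (1 / τ₀) ^ (κ - 1)) * (g * T ^ (κ - 1) + M ^ κ)) := by
          gcongr; nlinarith [mul_nonneg hτκ hMκ]
      _ = _ := by ring
  · push Not at hcase
    have hg0 : 0 < g := by
      rcases hg.eq_or_lt with h0 | h0
      · rw [← h0] at hcase; linarith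
      · exact h0
    have key := h1 (T / g) (by positivity) (by rw [div_le_iff₀ hg0]; linarith)
    have e1 : (T / g) ^ (1 - 1 / κ) * g = g ^ (1 / κ) * T ^ (1 - 1 / κ) := by
      rw [Real.div_rpow hT.le hg, Real.rpow_sub hg0, Real.rpow_one]
      field_simp
    have e2 : (T / g) ^ (-(1 / κ)) * T = g ^ (1 / κ) * T ^ (1 - 1 / κ) := by
      rw [Real.div_rpow hT.le hg, Real.rpow_sub hT, Real.rpow_one, Real.rpow_neg hT.le,
        Real.rpow_neg hg]
      field_simp
    rw [e1, e2] at key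
    have hm : U ≤ (2 * D + 1) * (g ^ (1 / κ) * T ^ (1 - 1 / κ)) := by
      have : 0 ≤ g ^ (1 / κ) * T ^ (1 - 1 / κ) := by positivity
      linarith
    calc U ^ κ ≤ ((2 * D + 1) * (g ^ (1 / κ) * T ^ (1 - 1 / κ))) ^ κ :=
          Real.rpow_le_rpow hU hm hκ0.le
      _ = (2 * D + 1) ^ κ * (g * T ^ (κ - 1)) := by
          rw [Real.mul_rpow (by positivity) (by positivity),
            Real.mul_rpow (by positivity) (by positivity), ← Real.rpow_mul hg,
            ← Real.rpow_mul hT.le]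
          congr 3
          · rw [one_div_mul_cancel hκ0.ne', Real.rpow_one]
          · field_simp
      _ ≤ (2 * D + 1) ^ κ * ((1 + (1 / τ₀) ^ (κ - 1)) * (g * T ^ (κ - 1) + M ^ κ)) := by
          refine mul_le_mul_of_nonneg_left ?_ hDκ
          nlinarith [mul_nonneg hτκ hMκ, mul_nonneg hτκ hgT]
      _ = _ := by ring

/-- If the `E` term dominates, divide by `T ^ (κ - 1)`; otherwise take `κ`-th roots. -/
lemma le_of_rpow_le_absorb {κ C W : ℝ} (hκ : 1 < κ) (hC : 0 < C) (hW : 0 ≤ W) :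
    ∃ C' : ℝ, 0 < C' ∧ ∀ E M T : ℝ, 0 ≤ E → 0 ≤ M → 0 < T →
      T ^ κ ≤ C * (E * T ^ (κ - 1) + W * M ^ κ) → T ≤ C' * (E + M) := by
  have hκ0 : 0 < κ := by linarith
  refine ⟨2 * C + (2 * C * W) ^ (1 / κ), by positivity, ?_⟩
  intro E M T hE hM hT h
  have hP : 0 ≤ (2 * C * W) ^ (1 / κ) := by positivity
  have hsplit : T ^ κ = T * T ^ (κ - 1) := by
    rw [← Real.rpow_one_add' hT.le (by linarith)]; ring_nf
  have hTp : 0 < T ^ (κ - 1) := by positivity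
  rcases le_total (W * M ^ κ) (E * T ^ (κ - 1)) with h1 | h1
  · have : T * T ^ (κ - 1) ≤ (2 * C * E) * T ^ (κ - 1) := by
      rw [← hsplit]; nlinarith
    have := le_of_mul_le_mul_right this hTp
    nlinarith [mul_nonneg hP hE, mul_nonneg hP hM]
  · have h2 : T ^ κ ≤ (2 * C * W) * M ^ κ := by nlinarith
    have h3 := Real.rpow_le_rpow (by positivity) h2 (z := 1 / κ) (by positivity)
    rw [Real.mul_rpow (by positivity) (by positivity), ← Real.rpow_mul hT.le, ← Real.rpow_mul hM,
      mul_one_div_cancel hκ0.ne', Real.rpow_one, Real.rpow_one] at h3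
    nlinarith [mul_nonneg hP hE, mul_nonneg hP hM]

/-! ### The fractional Sobolev inequality under a lower volume bound -/

/-- The double integral `∬ |u(x) - u(y)|ᵖ / d(x,y)ᵉ`. -/
def energy {X : Type*} [MeasurableSpace X] (μ : Measure X) (d : X → X → ℝ) (p e : ℝ)
    (u : X → ℝ) : ℝ≥0∞ :=
  ∫⁻ x, ∫⁻ y, ENNReal.ofReal (|u x - u y| ^ p / d x y ^ e) ∂μ ∂μ

/-- A nonnegative bounded kernel vanishing only on the diagonal, whose balls have measure
at least `c r ^ Q`. -/
structure LowerRegular {X : Type*} [MeasurableSpace X] (μ : Measure X) (d : X → X → ℝ)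
    (Q R c : ℝ) : Prop where
  measurable : ∀ x, Measurable (d x)
  nonneg : ∀ x y, 0 ≤ d x y
  eq_of_eq_zero : ∀ x y, d x y = 0 → x = y
  le : ∀ x y, d x y ≤ R
  pos_radius : 0 < R
  pos_const : 0 < c
  ball_ge : ∀ x r, 0 < r → r ≤ R → ENNReal.ofReal (c * r ^ Q) ≤ μ {y | d x y ≤ r}

/-- Where `d` vanishes the quotient carries no information, but there `x = y` and the left side is
zero. -/
lemma enorm_sub_rpow_le {X : Type*} {d : X → X → ℝ} (h0 : ∀ x y, 0 ≤ d x y)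
    (h1 : ∀ x y, d x y = 0 → x = y) {p e : ℝ} (hp : 0 < p) (he : 0 ≤ e) (u : X → ℝ) {x y : X} {r : ℝ}
    (hr : d x y ≤ r) :
    ‖u x - u y‖ₑ ^ p ≤ ENNReal.ofReal (r ^ e) * ENNReal.ofReal (|u x - u y| ^ p / d x y ^ e) := by
  have hr0 : 0 ≤ r := (h0 x y).trans hr
  rw [← ENNReal.ofReal_mul (by positivity), Real.enorm_eq_ofReal_abs,
    ENNReal.ofReal_rpow_of_nonneg (abs_nonneg _) hp.le]
  apply ENNReal.ofReal_le_ofReal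
  rcases (h0 x y).eq_or_lt with h | h
  · rw [h1 x y h.symm]; simp [Real.zero_rpow hp.ne']
  · rw [mul_div_assoc', le_div_iff₀ (by positivity), mul_comm]
    gcongr

/-- Compare `u x` with `u y` and integrate over `y` in the ball; the difference is paid for by the
kernel, which is at least `r ^ (-e)` there. -/
lemma ball_average_le {X : Type*} [MeasurableSpace X] {μ : Measure X}
    {d : X → X → ℝ} {Q R c : ℝ} (H : LowerRegular μ d Q R c)
    {p e : ℝ} (hp : 1 ≤ p) (he : 0 ≤ e) {u : X → ℝ} (hu : AEMeasurable u μ) (x : X) (r : ℝ) :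
    μ {y | d x y ≤ r} * ‖u x‖ₑ ^ p ≤ 2 ^ (p - 1) * (ENNReal.ofReal (r ^ e) *
      (∫⁻ y, ENNReal.ofReal (|u x - u y| ^ p / d x y ^ e) ∂μ) +
        ∫⁻ y in {y | d x y ≤ r}, ‖u y‖ₑ ^ p ∂μ) := by
  have hB : MeasurableSet {y | d x y ≤ r} := measurableSet_le (H.measurable x) measurable_const
  have hpow : (2 : ℝ≥0∞) ^ (p - 1) ≠ ∞ := ENNReal.rpow_ne_top_of_nonneg (by linarith) (by simp)
  calc μ {y | d x y ≤ r} * ‖u x‖ₑ ^ p = ∫⁻ y in {y | d x y ≤ r}, ‖u x‖ₑ ^ p ∂μ := by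
        rw [setLIntegral_const, mul_comm]
    _ ≤ ∫⁻ y in {y | d x y ≤ r}, 2 ^ (p - 1) * (ENNReal.ofReal (r ^ e) *
          ENNReal.ofReal (|u x - u y| ^ p / d x y ^ e) + ‖u y‖ₑ ^ p) ∂μ := by
        refine setLIntegral_mono' hB fun y hy => ?_
        calc ‖u x‖ₑ ^ p ≤ (‖u x - u y‖ₑ + ‖u y‖ₑ) ^ p := by
              gcongr
              simpa using enorm_add_le (u x - u y) (u y)
          _ ≤ 2 ^ (p - 1) * (‖u x - u y‖ₑ ^ p + ‖u y‖ₑ ^ p) :=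
              ENNReal.rpow_add_le_mul_rpow_add_rpow _ _ hp
          _ ≤ _ := by
              gcongr
              exact enorm_sub_rpow_le H.nonneg H.eq_of_eq_zero (by linarith) he u hy
    _ = 2 ^ (p - 1) * (ENNReal.ofReal (r ^ e) *
          (∫⁻ y in {y | d x y ≤ r}, ENNReal.ofReal (|u x - u y| ^ p / d x y ^ e) ∂μ) +
          ∫⁻ y in {y | d x y ≤ r}, ‖u y‖ₑ ^ p ∂μ) := by
        rw [lintegral_const_mul' _ _ hpow, lintegral_add_right', lintegral_const_mul' _ _ (by simp)]
        exact (hu.enorm.pow_const p).restrict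
    _ ≤ _ := by
        gcongr
        exact Measure.restrict_le_self

lemma lintegral_le_rpow_mul_measure {X : Type*} [MeasurableSpace X] {ν : Measure X} {κ : ℝ}
    (hκ : 1 < κ) {f : X → ℝ≥0∞} (hf : AEMeasurable f ν) :
    ∫⁻ x, f x ∂ν ≤ (∫⁻ x, f x ^ κ ∂ν) ^ (1 / κ) * ν Set.univ ^ (1 - 1 / κ) := by
  have hc := Real.HolderConjugate.conjExponent hκ
  have h := ENNReal.lintegral_mul_le_Lp_mul_Lq ν hc hf (aemeasurable_const (b := (1 : ℝ≥0∞)))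
  have e : 1 / κ.conjExponent = 1 - 1 / κ := by
    have := hc.inv_add_inv_eq_one
    rw [one_div, one_div]; linarith
  simpa [e, one_div] using h

/-- A Hedberg-type estimate. `T` stands for the `p`-th power of the `L^{κp}` norm and `M` for that
of the `L^p` norm. Hölder on a ball of measure `b` bounds `∫ |u|ᵖ` by `T b ^ (1 - 1/κ)`, and the
resulting bounds over all radii are optimised by `rpow_le_of_forall_scale`. -/
lemma sobolev_pointwise {X : Type*} [MeasurableSpace X] {μ : Measure X} [IsFiniteMeasure μ]
    {d : X → X → ℝ} {Q R c : ℝ} (H : LowerRegular μ d Q R c) {p σ κ : ℝ} (hp : 1 < p)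
    (hQ : 0 < Q) (hκ : 1 < κ) (hσ : σ = Q * (1 - 1 / κ)) :
    ∃ C : ℝ, 0 < C ∧ ∀ u : X → ℝ, AEMeasurable u μ → ∀ T M : ℝ, 0 < T → 0 ≤ M →
      ∫⁻ y, ‖u y‖ₑ ^ (κ * p) ∂μ ≤ ENNReal.ofReal (T ^ κ) →
      ∫⁻ y, ‖u y‖ₑ ^ p ∂μ ≤ ENNReal.ofReal M → ∀ x,
      ‖u x‖ₑ ^ (κ * p) ≤ ENNReal.ofReal C *
        ((∫⁻ y, ENNReal.ofReal (|u x - u y| ^ p / d x y ^ (Q + σ)) ∂μ) *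
          ENNReal.ofReal (T ^ (κ - 1)) + ENNReal.ofReal (M ^ κ)) := by
  have hR := H.pos_radius
  have hc := H.pos_const
  have hκ0 : 0 < κ := by linarith
  have hκ1 : 1 / κ < 1 := by rw [div_lt_one hκ0]; exact hκ
  have hσ0 : 0 < σ := by rw [hσ]; exact mul_pos hQ (by linarith)
  have hRQ : 0 < R ^ Q := by positivity
  -- The first two summands serve the balls of radius at most `R`, the bracket the single ball of
  -- radius `R` with `M` in place of Hölder.
  set D : ℝ := 2 ^ (p - 1) * (1 / c + c ^ (-(1 / κ)) + (R ^ σ / c + 1 / (c * R ^ Q))) with hD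
  have hD0 : 0 ≤ D := by positivity
  obtain ⟨C, hC, hCC⟩ := rpow_le_of_forall_scale hκ hD0 hRQ
  refine ⟨C, hC, fun u hu T M hT hM huT huM x => ?_⟩
  set G : ℝ≥0∞ := ∫⁻ y, ENNReal.ofReal (|u x - u y| ^ p / d x y ^ (Q + σ)) ∂μ with hG
  by_cases hGt : G = ∞
  · rw [hGt, ENNReal.top_mul (by simpa using Real.rpow_pos_of_pos hT _), top_add,
      ENNReal.mul_top (by simpa using hC)]
    exact le_top
  have hball : ∀ r m : ℝ, 0 < r → r ≤ R → 0 ≤ m →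
      ∫⁻ y in {y | d x y ≤ r}, ‖u y‖ₑ ^ p ∂μ ≤ ENNReal.ofReal m →
      μ.real {y | d x y ≤ r} * |u x| ^ p ≤ 2 ^ (p - 1) * (r ^ (Q + σ) * G.toReal + m) := by
    intro r m hr hrR hm h
    have h1 := ball_average_le H hp.le (by linarith : 0 ≤ Q + σ) hu x r
    rw [← hG] at h1
    have h2 : μ {y | d x y ≤ r} * ‖u x‖ₑ ^ p ≤ ENNReal.ofReal
        (2 ^ (p - 1) * (r ^ (Q + σ) * G.toReal + m)) := by
      refine h1.trans ?_
      rw [ENNReal.ofReal_mul (by positivity), ENNReal.ofReal_add (by positivity) hm,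
        ENNReal.ofReal_mul (by positivity), ENNReal.ofReal_toReal hGt,
        ← ENNReal.ofReal_rpow_of_pos (by norm_num : (0 : ℝ) < 2)]
      gcongr
      simp
    have h3 := ENNReal.toReal_mono ENNReal.ofReal_ne_top h2
    rw [ENNReal.toReal_ofReal (by positivity), ENNReal.toReal_mul, ← ENNReal.toReal_rpow] at h3
    simpa [Measure.real] using h3
  have hlow : ∀ r : ℝ, 0 < r → r ≤ R → c * r ^ Q ≤ μ.real {y | d x y ≤ r} := by
    intro r hr hrR
    have := ENNReal.toReal_mono (measure_ne_top _ _) (H.ball_ge x r hr hrR)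
    rwa [ENNReal.toReal_ofReal (by positivity)] at this
  have hfin := hCC (|u x| ^ p) G.toReal M T (by positivity) ENNReal.toReal_nonneg hM hT ?_ ?_
  · have e : ‖u x‖ₑ ^ (κ * p) = ENNReal.ofReal ((|u x| ^ p) ^ κ) := by
      rw [Real.enorm_eq_ofReal_abs, ENNReal.ofReal_rpow_of_nonneg (abs_nonneg _) (by positivity),
        ← Real.rpow_mul (abs_nonneg _), mul_comm p]
    rw [e]
    refine (ENNReal.ofReal_le_ofReal hfin).trans (le_of_eq ?_)
    rw [ENNReal.ofReal_mul hC.le, ENNReal.ofReal_add (by positivity) (by positivity),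
      ENNReal.ofReal_mul ENNReal.toReal_nonneg, ENNReal.ofReal_toReal hGt]
  · intro τ hτ hττ
    -- The scale parameter is the volume scale `τ = r ^ Q`.
    set r := τ ^ (1 / Q) with hr
    have hr0 : 0 < r := by positivity
    have hrQ : r ^ Q = τ := by
      rw [hr, ← Real.rpow_mul hτ.le, one_div_mul_cancel hQ.ne', Real.rpow_one]
    have hrR : r ≤ R := by
      have := Real.rpow_le_rpow hτ.le hττ (z := 1 / Q) (by positivity)
      rwa [← Real.rpow_mul hR.le, mul_one_div_cancel hQ.ne', Real.rpow_one] at this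
    have hrσ : r ^ (Q + σ) = τ * τ ^ (1 - 1 / κ) := by
      rw [Real.rpow_add hr0, hrQ, hr, ← Real.rpow_mul hτ.le, hσ]
      congr 2; field_simp
    set b := μ.real {y | d x y ≤ r} with hb
    have hcb : c * τ ≤ b := by rw [← hrQ]; exact hlow r hr0 hrR
    have hb0 : 0 < b := lt_of_lt_of_le (by positivity) hcb
    have hB := hball r (T * b ^ (1 - 1 / κ)) hr0 hrR (by positivity) ?_
    · rw [hrσ] at hB
      have h1 : |u x| ^ p ≤ 2 ^ (p - 1) *
          (τ / b * (τ ^ (1 - 1 / κ) * G.toReal) + b ^ (-(1 / κ)) * T) := by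
        have hbb : b ^ (1 - 1 / κ) = b * b ^ (-(1 / κ)) := by
          rw [sub_eq_add_neg, Real.rpow_add hb0, Real.rpow_one]
        rw [hbb] at hB
        refine le_of_mul_le_mul_left (hB.trans (le_of_eq ?_)) hb0
        field_simp
        exact hb
      have h2 : τ / b ≤ 1 / c := by
        rw [div_le_div_iff₀ hb0 hc]; linarith
      have h3 : b ^ (-(1 / κ)) ≤ c ^ (-(1 / κ)) * τ ^ (-(1 / κ)) := by
        rw [← Real.mul_rpow hc.le hτ.le]
        exact Real.rpow_le_rpow_of_nonpos (by positivity) hcb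
          (by have : 0 < 1 / κ := by positivity
              linarith)
      have hA : 0 ≤ τ ^ (1 - 1 / κ) * G.toReal := by positivity
      have hA' : 0 ≤ τ ^ (-(1 / κ)) * T := by positivity
      calc |u x| ^ p ≤ 2 ^ (p - 1) *
          (1 / c * (τ ^ (1 - 1 / κ) * G.toReal) + c ^ (-(1 / κ)) * τ ^ (-(1 / κ)) * T) := by
            refine h1.trans ?_
            gcongr
        _ ≤ 2 ^ (p - 1) * ((1 / c + c ^ (-(1 / κ)) + (R ^ σ / c + 1 / (c * R ^ Q))) *
            (τ ^ (1 - 1 / κ) * G.toReal + τ ^ (-(1 / κ)) * T)) := by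
            refine mul_le_mul_of_nonneg_left ?_ (by positivity)
            have i1 : 0 ≤ 1 / c := by positivity
            have i2 : 0 ≤ c ^ (-(1 / κ)) := by positivity
            have i3 : 0 ≤ R ^ σ / c + 1 / (c * R ^ Q) := by positivity
            nlinarith [mul_nonneg i1 hA', mul_nonneg i2 hA, mul_nonneg i3 (add_nonneg hA hA')]
        _ = _ := by rw [hD]; ring
    · have hh := lintegral_le_rpow_mul_measure (ν := μ.restrict {y | d x y ≤ r}) hκ
        ((hu.enorm.pow_const p).restrict)
      refine hh.trans ?_
      rw [ENNReal.ofReal_mul hT.le, Measure.restrict_apply_univ, ← ENNReal.ofReal_rpow_of_pos hb0,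
        hb, ofReal_measureReal]
      gcongr
      have e : ∀ y, (‖u y‖ₑ ^ p) ^ κ = ‖u y‖ₑ ^ (κ * p) := fun y => by
        rw [← ENNReal.rpow_mul, mul_comm]
      simp_rw [e]
      calc (∫⁻ y in {y | d x y ≤ r}, ‖u y‖ₑ ^ (κ * p) ∂μ) ^ (1 / κ)
          ≤ (ENNReal.ofReal (T ^ κ)) ^ (1 / κ) := by
            gcongr
            exact (lintegral_mono' Measure.restrict_le_self le_rfl).trans huT
        _ = ENNReal.ofReal T := by
            rw [ENNReal.ofReal_rpow_of_pos (by positivity), ← Real.rpow_mul hT.le,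
              mul_one_div_cancel hκ0.ne', Real.rpow_one]
  · have hB := hball R M hR le_rfl hM
      ((lintegral_mono' Measure.restrict_le_self le_rfl).trans huM)
    have hcb := hlow R hR le_rfl
    have hU : 0 ≤ |u x| ^ p := by positivity
    have hg : 0 ≤ G.toReal := ENNReal.toReal_nonneg
    have h1 : c * R ^ Q * |u x| ^ p ≤ 2 ^ (p - 1) * (R ^ (Q + σ) * G.toReal + M) :=
      (mul_le_mul_of_nonneg_right hcb hU).trans hB
    have h2 : |u x| ^ p ≤ 2 ^ (p - 1) * (R ^ σ / c * G.toReal + 1 / (c * R ^ Q) * M) := by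
      refine le_of_mul_le_mul_left (h1.trans (le_of_eq ?_)) (by positivity : 0 < c * R ^ Q)
      rw [Real.rpow_add hR]
      field_simp
    refine h2.trans ?_
    rw [hD, mul_assoc]
    refine mul_le_mul_of_nonneg_left ?_ (by positivity)
    have i1 : 0 ≤ 1 / c + c ^ (-(1 / κ)) := by positivity
    have i2 : 0 ≤ R ^ σ / c := by positivity
    have i3 : 0 ≤ 1 / (c * R ^ Q) := by positivity
    nlinarith [mul_nonneg i1 (add_nonneg hg hM), mul_nonneg i2 hM, mul_nonneg i3 hg]

/-- The integral splits without measurability of `G`, the other summand being constant; so the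
kernel need not be jointly measurable. -/
lemma lintegral_energy_add_le {X : Type*} [MeasurableSpace X] {μ : Measure X} {G f : X → ℝ≥0∞}
    {C T M : ℝ≥0∞} (hC : C ≠ ∞) (hT : T ≠ ∞) (h : ∀ x, f x ≤ C * (G x * T + M)) :
    ∫⁻ x, f x ∂μ ≤ C * ((∫⁻ x, G x ∂μ) * T + μ Set.univ * M) := by
  refine (lintegral_mono h).trans (le_of_eq ?_)
  rw [lintegral_const_mul' _ _ hC, lintegral_add_right _ measurable_const,
    lintegral_mul_const' _ _ hT, lintegral_const, mul_comm M]

/-- Fractional Sobolev inequality for functions already known to be in `L^q`, `q = κ p`. -/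
lemma sobolev_of_finite {X : Type*} [MeasurableSpace X] {μ : Measure X} [IsFiniteMeasure μ]
    {d : X → X → ℝ} {Q R c : ℝ} (H : LowerRegular μ d Q R c) {p σ κ : ℝ} (hp : 1 < p)
    (hQ : 0 < Q) (hκ : 1 < κ) (hσ : σ = Q * (1 - 1 / κ)) :
    ∃ C : ℝ, 0 < C ∧ ∀ u : X → ℝ, AEMeasurable u μ → energy μ d p (Q + σ) u ≠ ∞ →
      ∫⁻ y, ‖u y‖ₑ ^ p ∂μ ≠ ∞ → ∫⁻ y, ‖u y‖ₑ ^ (κ * p) ∂μ ≠ ∞ →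
      (∫⁻ y, ‖u y‖ₑ ^ (κ * p) ∂μ) ^ (1 / κ) ≤
        ENNReal.ofReal C * (energy μ d p (Q + σ) u + ∫⁻ y, ‖u y‖ₑ ^ p ∂μ) := by
  have hκ0 : 0 < κ := by linarith
  obtain ⟨C, hC, hCC⟩ := sobolev_pointwise H hp hQ hκ hσ
  obtain ⟨C', hC', hCC'⟩ := le_of_rpow_le_absorb hκ hC (measureReal_nonneg (μ := μ) (s := Set.univ))
  refine ⟨C', hC', fun u hu hE hM hI => ?_⟩
  set I := ∫⁻ y, ‖u y‖ₑ ^ (κ * p) ∂μ with hIdef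
  set M := ∫⁻ y, ‖u y‖ₑ ^ p ∂μ with hMdef
  rcases eq_or_ne I 0 with h0 | h0
  · rw [h0, ENNReal.zero_rpow_of_pos (by positivity)]; exact zero_le
  set T : ℝ := I.toReal ^ (1 / κ) with hTdef
  have hI0 : 0 < I.toReal := ENNReal.toReal_pos h0 hI
  have hT : 0 < T := by positivity
  have hTκ : T ^ κ = I.toReal := by
    rw [hTdef, ← Real.rpow_mul hI0.le, one_div_mul_cancel hκ0.ne', Real.rpow_one]
  have hpt := hCC u hu T M.toReal hT ENNReal.toReal_nonneg
    (by rw [hTκ, ENNReal.ofReal_toReal hI]) (by rw [ENNReal.ofReal_toReal hM])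
  have hint : I ≤ ENNReal.ofReal C * (energy μ d p (Q + σ) u * ENNReal.ofReal (T ^ (κ - 1)) +
      μ Set.univ * ENNReal.ofReal (M.toReal ^ κ)) :=
    lintegral_energy_add_le (μ := μ) ENNReal.ofReal_ne_top ENNReal.ofReal_ne_top hpt
  have hreal := ENNReal.toReal_mono (by
    refine ENNReal.mul_ne_top ENNReal.ofReal_ne_top (ENNReal.add_ne_top.2
      ⟨ENNReal.mul_ne_top hE ENNReal.ofReal_ne_top,
        ENNReal.mul_ne_top (measure_ne_top _ _) ENNReal.ofReal_ne_top⟩)) hint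
  rw [ENNReal.toReal_mul, ENNReal.toReal_add (ENNReal.mul_ne_top hE ENNReal.ofReal_ne_top)
    (ENNReal.mul_ne_top (measure_ne_top _ _) ENNReal.ofReal_ne_top), ENNReal.toReal_mul,
    ENNReal.toReal_mul, ENNReal.toReal_ofReal hC.le, ENNReal.toReal_ofReal (by positivity),
    ENNReal.toReal_ofReal (by positivity), ← hTκ] at hreal
  have := hCC' (energy μ d p (Q + σ) u).toReal M.toReal T ENNReal.toReal_nonneg
    ENNReal.toReal_nonneg hT hreal
  have h2 := ENNReal.ofReal_le_ofReal this
  rw [ENNReal.ofReal_mul hC'.le, ENNReal.ofReal_add ENNReal.toReal_nonneg ENNReal.toReal_nonneg,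
    ENNReal.ofReal_toReal hE, ENNReal.ofReal_toReal hM, hTdef,
    ← ENNReal.ofReal_rpow_of_pos hI0, ENNReal.ofReal_toReal hI] at h2
  exact h2

/-- Truncation is 1-Lipschitz, hence does not increase the energy. -/
lemma abs_clamp_sub_clamp_le (N a b : ℝ) :
    |max (-N) (min a N) - max (-N) (min b N)| ≤ |a - b| :=
  (abs_max_sub_max_le_max _ _ _ _).trans (by
    simpa using abs_min_sub_min_le_max a N b N)

lemma abs_clamp_le {N : ℝ} (hN : 0 ≤ N) (a : ℝ) : |max (-N) (min a N)| ≤ N :=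
  abs_le.2 ⟨le_max_left _ _, max_le (by linarith) (min_le_right _ _)⟩

lemma energy_mono {X : Type*} [MeasurableSpace X] {μ : Measure X} {d : X → X → ℝ} {p e : ℝ}
    (h0 : ∀ x y, 0 ≤ d x y) (hp : 0 ≤ p) {u v : X → ℝ} (h : ∀ x y, |u x - u y| ≤ |v x - v y|) :
    energy μ d p e u ≤ energy μ d p e v := by
  refine lintegral_mono fun x => lintegral_mono fun y => ENNReal.ofReal_le_ofReal ?_
  have := h0 x y
  have := h x y
  gcongr

/-- Fractional Sobolev inequality. -/
lemma sobolev {X : Type*} [MeasurableSpace X] {μ : Measure X} [IsFiniteMeasure μ]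
    {d : X → X → ℝ} {Q R c : ℝ} (H : LowerRegular μ d Q R c) {p σ κ : ℝ} (hp : 1 < p)
    (hQ : 0 < Q) (hκ : 1 < κ) (hσ : σ = Q * (1 - 1 / κ)) :
    ∃ C : ℝ, 0 < C ∧ ∀ u : X → ℝ, AEMeasurable u μ → energy μ d p (Q + σ) u ≠ ∞ →
      ∫⁻ y, ‖u y‖ₑ ^ p ∂μ ≠ ∞ →
      (∫⁻ y, ‖u y‖ₑ ^ (κ * p) ∂μ) ^ (1 / κ) ≤
        ENNReal.ofReal C * (energy μ d p (Q + σ) u + ∫⁻ y, ‖u y‖ₑ ^ p ∂μ) := by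
  have hκ0 : 0 < κ := by linarith
  have hq0 : 0 ≤ κ * p := by positivity
  obtain ⟨C, hC, hCC⟩ := sobolev_of_finite H hp hQ hκ hσ
  refine ⟨C, hC, fun u hu hE hM => ?_⟩
  -- Absorption needs a finite `L^{κp}` norm. Truncations are bounded on a finite measure space, so
  -- they have one, and they obey a bound independent of `N`; Fatou then passes to `u`.
  set uN : ℕ → X → ℝ := fun N x => max (-(N : ℝ)) (min (u x) N) with huN
  set B := ENNReal.ofReal C * (energy μ d p (Q + σ) u + ∫⁻ y, ‖u y‖ₑ ^ p ∂μ) with hB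
  have hmeas : ∀ N, AEMeasurable (uN N) μ := fun N =>
    aemeasurable_const.max (hu.min aemeasurable_const)
  have habs : ∀ N x, |uN N x| ≤ |u x| := fun N x => by
    have := abs_clamp_sub_clamp_le N (u x) 0
    simpa [huN] using this
  have hEN : ∀ N, energy μ d p (Q + σ) (uN N) ≤ energy μ d p (Q + σ) u := fun N =>
    energy_mono H.nonneg (by linarith) fun x y => abs_clamp_sub_clamp_le N (u x) (u y)
  have hMN : ∀ N, ∫⁻ y, ‖uN N y‖ₑ ^ p ∂μ ≤ ∫⁻ y, ‖u y‖ₑ ^ p ∂μ := fun N =>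
    lintegral_mono fun y => by
      have := habs N y
      have h2 : ‖uN N y‖ₑ ≤ ‖u y‖ₑ := by
        rw [Real.enorm_eq_ofReal_abs, Real.enorm_eq_ofReal_abs]
        exact ENNReal.ofReal_le_ofReal this
      gcongr
  have hfin : ∀ N, ∫⁻ y, ‖uN N y‖ₑ ^ (κ * p) ∂μ ≤ B ^ κ := fun N => by
    have hI : ∫⁻ y, ‖uN N y‖ₑ ^ (κ * p) ∂μ ≠ ∞ := by
      refine ne_top_of_le_ne_top (b := ENNReal.ofReal N ^ (κ * p) * μ Set.univ) ?_ ?_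
      · exact ENNReal.mul_ne_top (ENNReal.rpow_ne_top_of_nonneg hq0 ENNReal.ofReal_ne_top)
          (measure_ne_top _ _)
      · rw [← lintegral_const]
        refine lintegral_mono fun y => ?_
        have h2 : ‖uN N y‖ₑ ≤ ENNReal.ofReal N := by
          rw [Real.enorm_eq_ofReal_abs]
          exact ENNReal.ofReal_le_ofReal (abs_clamp_le N.cast_nonneg _)
        gcongr
    have h1 := hCC (uN N) (hmeas N) (ne_top_of_le_ne_top hE (hEN N))
      (ne_top_of_le_ne_top hM (hMN N)) hI
    have h2 : (∫⁻ y, ‖uN N y‖ₑ ^ (κ * p) ∂μ) ^ (1 / κ) ≤ B := by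
      exact h1.trans (mul_le_mul' le_rfl (add_le_add (hEN N) (hMN N)))
    have h3 := ENNReal.rpow_le_rpow h2 hκ0.le
    rwa [← ENNReal.rpow_mul, one_div_mul_cancel hκ0.ne', ENNReal.rpow_one] at h3
  have hlim : ∫⁻ y, ‖u y‖ₑ ^ (κ * p) ∂μ ≤ B ^ κ := by
    calc ∫⁻ y, ‖u y‖ₑ ^ (κ * p) ∂μ
        = ∫⁻ y, liminf (fun N => ‖uN N y‖ₑ ^ (κ * p)) atTop ∂μ := by
          refine lintegral_congr fun y => ?_
          refine (Tendsto.liminf_eq (tendsto_const_nhds.congr' ?_)).symm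
          obtain ⟨N₀, hN₀⟩ := exists_nat_ge |u y|
          filter_upwards [eventually_ge_atTop N₀] with N hN
          have h1 : |u y| ≤ N := hN₀.trans (by exact_mod_cast hN)
          have h2 := abs_le.1 h1
          simp only [huN]
          rw [min_eq_left h2.2, max_eq_right h2.1]
      _ ≤ liminf (fun N => ∫⁻ y, ‖uN N y‖ₑ ^ (κ * p) ∂μ) atTop :=
          lintegral_liminf_le' fun N => (hmeas N).enorm.pow_const _
      _ ≤ liminf (fun _ : ℕ => B ^ κ) atTop := liminf_le_liminf (Eventually.of_forall hfin)
      _ = B ^ κ := liminf_const _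
  have h3 := ENNReal.rpow_le_rpow hlim (by positivity : 0 ≤ 1 / κ)
  rwa [← ENNReal.rpow_mul, mul_one_div_cancel hκ0.ne', ENNReal.rpow_one] at h3

lemma enorm_integral_rpow_le {X : Type*} [MeasurableSpace X] {μ : Measure X} [IsFiniteMeasure μ]
    {p : ℝ} (hp : 1 < p) {f : X → ℝ} (hf : AEMeasurable f μ) :
    ‖∫ x, f x ∂μ‖ₑ ^ p ≤ (∫⁻ x, ‖f x‖ₑ ^ p ∂μ) * μ Set.univ ^ (p - 1) := by
  have hp0 : 0 < p := by linarith
  have h := (enorm_integral_le_lintegral_enorm f).trans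
    (lintegral_le_rpow_mul_measure hp hf.enorm)
  have h2 := ENNReal.rpow_le_rpow h hp0.le
  rw [ENNReal.mul_rpow_of_nonneg _ _ hp0.le, ← ENNReal.rpow_mul, ← ENNReal.rpow_mul,
    one_div_mul_cancel hp0.ne', ENNReal.rpow_one] at h2
  convert h2 using 3
  field_simp

/-! ### Real exponents, Jensen and the Sobolev–Poincaré inequality -/

lemma memLp_ofReal_iff {X : Type*} [MeasurableSpace X] {μ : Measure X} {r : ℝ} (hr : 0 < r)
    {u : X → ℝ} : MemLp u (ENNReal.ofReal r) μ ↔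
      AEStronglyMeasurable u μ ∧ ∫⁻ x, ‖u x‖ₑ ^ r ∂μ ≠ ∞ := by
  have h0 : ENNReal.ofReal r ≠ 0 := by simpa using hr
  rw [MemLp, eLpNorm_lt_top_iff_lintegral_rpow_enorm_lt_top h0 ENNReal.ofReal_ne_top,
    ENNReal.toReal_ofReal hr.le, lt_top_iff_ne_top]

lemma integral_abs_rpow_eq_toReal {X : Type*} [MeasurableSpace X] {μ : Measure X} {r : ℝ}
    (hr : 0 < r) {u : X → ℝ} (hu : AEStronglyMeasurable u μ) :
    ∫ x, |u x| ^ r ∂μ = (∫⁻ x, ‖u x‖ₑ ^ r ∂μ).toReal := by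
  have hm : AEStronglyMeasurable (fun x => |u x| ^ r) μ := by
    simpa using (hu.norm.aemeasurable.pow_const r).aestronglyMeasurable
  rw [integral_eq_lintegral_of_nonneg_ae (Eventually.of_forall fun x => by positivity) hm]
  congr 1
  refine lintegral_congr fun x => ?_
  rw [Real.enorm_eq_ofReal_abs, ENNReal.ofReal_rpow_of_nonneg (abs_nonneg _) hr.le]

lemma toReal_eLpNorm_rpow {X : Type*} [MeasurableSpace X] {μ : Measure X} {r : ℝ} (hr : 0 < r)
    (t : ℝ) {u : X → ℝ} (hu : AEStronglyMeasurable u μ) :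
    (eLpNorm u (ENNReal.ofReal r) μ).toReal ^ t = (∫ x, |u x| ^ r ∂μ) ^ (t / r) := by
  have h0 : ENNReal.ofReal r ≠ 0 := by simpa using hr
  rw [integral_abs_rpow_eq_toReal hr hu, eLpNorm_eq_lintegral_rpow_enorm_toReal h0
    ENNReal.ofReal_ne_top, ENNReal.toReal_ofReal hr.le, ← ENNReal.toReal_rpow,
    ← Real.rpow_mul ENNReal.toReal_nonneg]
  congr 1
  ring

lemma integrable_abs_rpow {X : Type*} [MeasurableSpace X] {μ : Measure X} {r : ℝ} (hr : 0 < r)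
    {u : X → ℝ} (hu : MemLp u (ENNReal.ofReal r) μ) : Integrable (fun x => |u x| ^ r) μ := by
  have h0 : ENNReal.ofReal r ≠ 0 := by simpa using hr
  have := hu.integrable_norm_rpow h0 ENNReal.ofReal_ne_top
  simpa [ENNReal.toReal_ofReal hr.le] using this

lemma memLp_ofReal_mono {X : Type*} [MeasurableSpace X] {μ : Measure X} [IsFiniteMeasure μ]
    {r r' : ℝ} (h : r ≤ r') {u : X → ℝ} (hu : MemLp u (ENNReal.ofReal r') μ) :
    MemLp u (ENNReal.ofReal r) μ :=
  hu.mono_exponent (ENNReal.ofReal_le_ofReal h)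

lemma integrable_of_memLp_ofReal {X : Type*} [MeasurableSpace X] {μ : Measure X}
    [IsFiniteMeasure μ] {r : ℝ} (h : 1 ≤ r) {u : X → ℝ} (hu : MemLp u (ENNReal.ofReal r) μ) :
    Integrable u μ := by
  rw [← memLp_one_iff_integrable]
  exact hu.mono_exponent (by simpa using ENNReal.ofReal_le_ofReal h)

/-- Jensen: `|mean u|ᵖ ≤ mean |u|ᵖ`. -/
lemma abs_average_rpow_le {X : Type*} [MeasurableSpace X] {μ : Measure X} [IsFiniteMeasure μ]
    (hμ : 0 < μ.real Set.univ) {p : ℝ} (hp : 1 < p) {u : X → ℝ}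
    (hu : MemLp u (ENNReal.ofReal p) μ) :
    |⨍ x, u x ∂μ| ^ p ≤ (μ.real Set.univ)⁻¹ * ∫ x, |u x| ^ p ∂μ := by
  have hp0 : 0 < p := by linarith
  have hfin := ((memLp_ofReal_iff hp0).1 hu).2
  have h := enorm_integral_rpow_le hp hu.1.aemeasurable
  have h2 := ENNReal.toReal_mono (ENNReal.mul_ne_top hfin
    (ENNReal.rpow_ne_top_of_nonneg (by linarith) (measure_ne_top _ _))) h
  rw [← ENNReal.toReal_rpow, toReal_enorm, ENNReal.toReal_mul, ← ENNReal.toReal_rpow,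
    ← integral_abs_rpow_eq_toReal hp0 hu.1] at h2
  rw [average_eq, smul_eq_mul, abs_mul, Real.mul_rpow (abs_nonneg _) (abs_nonneg _),
    abs_of_pos (inv_pos.2 hμ), Real.inv_rpow hμ.le]
  calc (μ.real Set.univ ^ p)⁻¹ * |∫ x, u x ∂μ| ^ p
      ≤ (μ.real Set.univ ^ p)⁻¹ * ((∫ x, |u x| ^ p ∂μ) * μ.real Set.univ ^ (p - 1)) := by
        gcongr
        exact h2
    _ = _ := by
        rw [Real.rpow_sub hμ, Real.rpow_one]
        field_simp

lemma energy_sub_const {X : Type*} [MeasurableSpace X] (μ : Measure X) (d : X → X → ℝ) (p e : ℝ)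
    (u : X → ℝ) (m : ℝ) : energy μ d p e (fun x => u x - m) = energy μ d p e u := by
  simp [energy]

/-- `u x - mean` is the average of `u x - u y` over `y`; Hölder moves the power inside, and `d ≤ R`
bounds the kernel from below. -/
lemma poincare {X : Type*} [MeasurableSpace X] {μ : Measure X} [IsFiniteMeasure μ]
    (hμ : 0 < μ.real Set.univ) {d : X → X → ℝ} {Q R c : ℝ} (H : LowerRegular μ d Q R c)
    {p e : ℝ} (hp : 1 < p) (he : 0 ≤ e) {u : X → ℝ} (hu : Integrable u μ) :
    ∫⁻ x, ‖u x - ⨍ y, u y ∂μ‖ₑ ^ p ∂μ ≤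
      ENNReal.ofReal ((μ.real Set.univ)⁻¹ * R ^ e) * energy μ d p e u := by
  have hp0 : 0 < p := by linarith
  have hR := H.pos_radius
  rw [energy, ← lintegral_const_mul' _ _ ENNReal.ofReal_ne_top]
  refine lintegral_mono fun x => ?_
  have hmean : u x - ⨍ y, u y ∂μ = (μ.real Set.univ)⁻¹ * ∫ y, (u x - u y) ∂μ := by
    rw [integral_sub (integrable_const _) hu, integral_const, smul_eq_mul, average_eq, smul_eq_mul]
    field_simp
  have hJ := enorm_integral_rpow_le (μ := μ) hp
    (f := fun y => u x - u y) (aemeasurable_const.sub hu.aemeasurable)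
  have hK : ∫⁻ y, ‖u x - u y‖ₑ ^ p ∂μ ≤ ENNReal.ofReal (R ^ e) *
      ∫⁻ y, ENNReal.ofReal (|u x - u y| ^ p / d x y ^ e) ∂μ := by
    rw [← lintegral_const_mul' _ _ ENNReal.ofReal_ne_top]
    exact lintegral_mono fun y => enorm_sub_rpow_le H.nonneg H.eq_of_eq_zero hp0 he u (H.le x y)
  rw [hmean, enorm_mul, ENNReal.mul_rpow_of_nonneg _ _ hp0.le]
  have e1 : ‖(μ.real Set.univ)⁻¹‖ₑ ^ p * μ Set.univ ^ (p - 1) =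
      ENNReal.ofReal (μ.real Set.univ)⁻¹ := by
    rw [Real.enorm_eq_ofReal (by positivity), ENNReal.ofReal_rpow_of_pos (by positivity),
      ← ofReal_measureReal (μ := μ) (s := Set.univ), ENNReal.ofReal_rpow_of_pos hμ,
      ← ENNReal.ofReal_mul (by positivity)]
    congr 1
    rw [Real.inv_rpow hμ.le, Real.rpow_sub hμ, Real.rpow_one]
    field_simp
  calc ‖(μ.real Set.univ)⁻¹‖ₑ ^ p * ‖∫ y, (u x - u y) ∂μ‖ₑ ^ p
      ≤ ‖(μ.real Set.univ)⁻¹‖ₑ ^ p * ((ENNReal.ofReal (R ^ e) *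
      ∫⁻ y, ENNReal.ofReal (|u x - u y| ^ p / d x y ^ e) ∂μ) * μ Set.univ ^ (p - 1)) := by
        gcongr
        exact hJ.trans (mul_le_mul' hK le_rfl)
    _ = (‖(μ.real Set.univ)⁻¹‖ₑ ^ p * μ Set.univ ^ (p - 1)) * (ENNReal.ofReal (R ^ e) *
      ∫⁻ y, ENNReal.ofReal (|u x - u y| ^ p / d x y ^ e) ∂μ) := by ring
    _ = _ := by
        rw [e1, ENNReal.ofReal_mul (by positivity), mul_assoc]

/-- Fractional Sobolev–Poincaré inequality. -/
lemma sobolev_poincare {X : Type*} [MeasurableSpace X] {μ : Measure X} [IsFiniteMeasure μ]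
    (hμ : 0 < μ.real Set.univ) {d : X → X → ℝ} {Q R c : ℝ} (H : LowerRegular μ d Q R c)
    {p σ κ : ℝ} (hp : 1 < p) (hQ : 0 < Q) (hκ : 1 < κ) (hσ : σ = Q * (1 - 1 / κ)) :
    ∃ K : ℝ, 0 < K ∧ ∀ u : X → ℝ, MemLp u (ENNReal.ofReal p) μ → energy μ d p (Q + σ) u ≠ ∞ →
      MemLp u (ENNReal.ofReal (κ * p)) μ ∧
      (∫ x, |u x - ⨍ y, u y ∂μ| ^ (κ * p) ∂μ) ^ (1 / κ) ≤
        K * (energy μ d p (Q + σ) u).toReal := by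
  have hp0 : 0 < p := by linarith
  have hκ0 : 0 < κ := by linarith
  have hq0 : 0 < κ * p := by positivity
  have hκ1 : 1 / κ < 1 := by rw [div_lt_one hκ0]; exact hκ
  have hσ0 : 0 < σ := by rw [hσ]; exact mul_pos hQ (by linarith)
  have hR := H.pos_radius
  obtain ⟨C, hC, hCC⟩ := sobolev H hp hQ hκ hσ
  refine ⟨C * (1 + (μ.real Set.univ)⁻¹ * R ^ (Q + σ)), by positivity, fun u hu hE => ?_⟩
  set m := ⨍ y, u y ∂μ
  have hint := integrable_of_memLp_ofReal hp.le hu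
  have hP := poincare hμ H hp (by linarith : 0 ≤ Q + σ) hint
  have hvm : AEStronglyMeasurable (fun x => u x - m) μ := hu.1.sub aestronglyMeasurable_const
  have hPfin := ne_top_of_le_ne_top (ENNReal.mul_ne_top ENNReal.ofReal_ne_top hE) hP
  have hS := hCC (fun x => u x - m) hvm.aemeasurable
    (by rw [energy_sub_const]; exact hE) hPfin
  rw [energy_sub_const] at hS
  have hS2 : (∫⁻ y, ‖u y - m‖ₑ ^ (κ * p) ∂μ) ^ (1 / κ) ≤
      ENNReal.ofReal (C * (1 + (μ.real Set.univ)⁻¹ * R ^ (Q + σ))) * energy μ d p (Q + σ) u := by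
    refine hS.trans ?_
    rw [ENNReal.ofReal_mul hC.le, ENNReal.ofReal_add (by positivity) (by positivity), mul_assoc,
      add_mul, ENNReal.ofReal_one, one_mul]
    gcongr
  have htop := ne_top_of_le_ne_top (ENNReal.mul_ne_top ENNReal.ofReal_ne_top hE) hS2
  have hI : ∫⁻ y, ‖u y - m‖ₑ ^ (κ * p) ∂μ ≠ ∞ := fun h => htop (by
    rw [h, ENNReal.top_rpow_of_pos (by positivity)])
  have hv : MemLp (fun x => u x - m) (ENNReal.ofReal (κ * p)) μ :=
    (memLp_ofReal_iff hq0).2 ⟨hvm, hI⟩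
  refine ⟨?_, ?_⟩
  · convert hv.add (memLp_const m) using 1
    ext x
    simp
  · have := ENNReal.toReal_mono (ENNReal.mul_ne_top ENNReal.ofReal_ne_top hE) hS2
    rw [ENNReal.toReal_mul, ENNReal.toReal_ofReal (by positivity), ← ENNReal.toReal_rpow,
      ← integral_abs_rpow_eq_toReal hq0 hvm] at this
    exact this

/-! ### First order expansion and the sharp splitting for `p ≤ 2` -/

lemma exists_abs_rpow_sub_le (a : ℝ) :
    ∃ L : ℝ, 0 < L ∧ ∀ x ∈ Set.Icc (1 / 2 : ℝ) (3 / 2), ∀ y ∈ Set.Icc (1 / 2 : ℝ) (3 / 2),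
      |x ^ a - y ^ a| ≤ L * |x - y| := by
  have h : ContDiffOn ℝ 1 (fun x : ℝ => x ^ a) (Set.Icc (1 / 2 : ℝ) (3 / 2)) := fun x hx =>
    (Real.contDiffAt_rpow_const_of_ne (by have := hx.1; linarith)).contDiffWithinAt
  obtain ⟨K, hK⟩ := h.exists_lipschitzOnWith one_ne_zero (convex_Icc _ _) isCompact_Icc
  refine ⟨K + 1, by positivity, fun x hx y hy => ?_⟩
  have := hK.dist_le_mul x hx y hy
  rw [Real.dist_eq, Real.dist_eq] at this
  nlinarith [abs_nonneg (x - y)]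

/-- A first order upper bound for `|1 + t| ^ q` with remainder of order `min (p, q) ≤ 2`. -/
lemma abs_one_add_rpow_le {p q : ℝ} (hp : 0 < p) (hp2 : p ≤ 2) (hq : 1 < q) :
    ∃ C : ℝ, 1 ≤ C ∧ ∀ t : ℝ, |1 + t| ^ q ≤ 1 + q * t + C * (|t| ^ p + |t| ^ q) := by
  obtain ⟨L, hL, hLL⟩ := exists_abs_rpow_sub_le (q - 1)
  refine ⟨1 + q * L + (3 ^ q + q * 2 ^ q), by
    have : 0 < q * L := by positivity
    have : (0 : ℝ) < 3 ^ q + q * 2 ^ q := by positivity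
    linarith, fun t => ?_⟩
  have h3 : (0 : ℝ) < 3 ^ q := by positivity
  have h2 : (0 : ℝ) < q * 2 ^ q := by positivity
  have hqL : 0 < q * L := by positivity
  have hP : 0 ≤ |t| ^ p := by positivity
  have hQ : 0 ≤ |t| ^ q := by positivity
  rcases le_total |t| (1 / 2) with ht | ht
  · have ⟨ht1, ht2⟩ := abs_le.1 ht
    have hpos : 0 < 1 + t := by linarith
    -- Bernoulli for `(1 + t)⁻¹ = 1 + (-t / (1 + t))` gives the upper bound `(1 + t) ^ q ≤ 1 + q t
    -- (1 + t) ^ (q - 1)`. The Lipschitz bound then replaces the last power by `1`, with an error of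
    -- order `t²`.
    have hs : -1 ≤ -t / (1 + t) := by rw [le_div_iff₀ hpos]; linarith
    have hB := one_add_mul_self_le_rpow_one_add hs hq.le
    have e1 : 1 + -t / (1 + t) = (1 + t)⁻¹ := by field_simp; ring
    rw [e1, Real.inv_rpow hpos.le] at hB
    have hTp : 0 < (1 + t) ^ q := by positivity
    have hB2 : (1 + t) ^ q ≤ 1 + q * t * (1 + t) ^ (q - 1) := by
      have := mul_le_mul_of_nonneg_left hB hTp.le
      rw [mul_inv_cancel₀ hTp.ne'] at this
      have e2 : (1 + t) ^ q = (1 + t) ^ (q - 1) * (1 + t) := by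
        rw [← Real.rpow_add_one hpos.ne']; ring_nf
      have e3 : (1 + t) ^ q * (1 + q * (-t / (1 + t))) =
          (1 + t) ^ q - q * t * (1 + t) ^ (q - 1) := by
        rw [e2]; field_simp; ring
      linarith
    have hl := hLL (1 + t) ⟨by linarith, by linarith⟩ 1 ⟨by norm_num, by norm_num⟩
    rw [Real.one_rpow] at hl
    have e4 : 1 + t - 1 = t := by ring
    rw [e4] at hl
    have h5 : t * ((1 + t) ^ (q - 1) - 1) ≤ L * |t| ^ p := by
      calc t * ((1 + t) ^ (q - 1) - 1) ≤ |t| * |(1 + t) ^ (q - 1) - 1| := by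
            rw [← abs_mul]; exact le_abs_self _
        _ ≤ |t| * (L * |t|) := by gcongr
        _ = L * |t| ^ (2 : ℝ) := by rw [Real.rpow_two]; ring
        -- The only use of `p ≤ 2`: the quadratic error is dominated by `|t| ^ p` for small `t`.
        _ ≤ L * |t| ^ p := by
            refine mul_le_mul_of_nonneg_left ?_ hL.le
            rcases (abs_nonneg t).eq_or_lt with h0 | h0
            · rw [← h0, Real.zero_rpow hp.ne', Real.zero_rpow (by norm_num)]
            · exact Real.rpow_le_rpow_of_exponent_ge h0 (by linarith) hp2
    rw [abs_of_pos hpos]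
    have h6 : (1 + t) ^ q ≤ 1 + q * t + q * (L * |t| ^ p) := by
      have : q * (t * ((1 + t) ^ (q - 1) - 1)) ≤ q * (L * |t| ^ p) := by gcongr
      linarith
    nlinarith [mul_nonneg hqL.le hQ, mul_nonneg h3.le hQ, mul_nonneg h3.le hP, mul_nonneg h2.le hP,
      mul_nonneg h2.le hQ]
  · have h6 : |1 + t| ^ q ≤ 3 ^ q * |t| ^ q := by
      rw [← Real.mul_rpow (by norm_num) (abs_nonneg _)]
      refine Real.rpow_le_rpow (abs_nonneg _) ?_ (by linarith)
      have := abs_add_le 1 t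
      rw [abs_one] at this
      linarith
    have h7 : -t ≤ 2 ^ q * |t| ^ q := by
      have : |t| ≤ 2 ^ q * |t| ^ q := by
        rw [← Real.mul_rpow (by norm_num) (abs_nonneg _)]
        have := Real.self_le_rpow_of_one_le (by linarith : (1 : ℝ) ≤ 2 * |t|) hq.le
        linarith
      linarith [neg_abs_le t]
    have h8 : q * -t ≤ q * (2 ^ q * |t| ^ q) := by gcongr
    nlinarith [mul_nonneg hqL.le hQ, mul_nonneg h3.le hQ, mul_nonneg h3.le hP, mul_nonneg h2.le hP,
      mul_nonneg h2.le hQ, mul_nonneg hqL.le hP]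

/-- Homogeneity: apply the case `a = 1` to `t / a`. The slope `b` may depend on `a` but not on `t`,
so its term disappears once `t` has mean zero. -/
lemma abs_add_rpow_le {p q : ℝ} (hp : 0 < p) (hp2 : p ≤ 2) (hq : 1 < q) (hpq : p < q) :
    ∃ C : ℝ, 1 ≤ C ∧ ∀ a : ℝ, ∃ b : ℝ, ∀ t : ℝ,
      |a + t| ^ q ≤ |a| ^ q + b * t + C * (|a| ^ (q - p) * |t| ^ p + |t| ^ q) := by
  obtain ⟨C, hC, hCC⟩ := abs_one_add_rpow_le hp hp2 hq
  refine ⟨C, hC, fun a => ?_⟩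
  rcases eq_or_ne a 0 with rfl | ha
  · refine ⟨0, fun t => ?_⟩
    rw [abs_zero, Real.zero_rpow (by linarith), Real.zero_rpow (by linarith), zero_add]
    have : 0 ≤ |t| ^ q := by positivity
    nlinarith
  · refine ⟨|a| ^ q * q / a, fun t => ?_⟩
    have ha' : 0 < |a| := abs_pos.2 ha
    have h := mul_le_mul_of_nonneg_left (hCC (t / a)) (by positivity : 0 ≤ |a| ^ q)
    have e1 : |a| ^ q * |1 + t / a| ^ q = |a + t| ^ q := by
      rw [← Real.mul_rpow (abs_nonneg _) (abs_nonneg _), ← abs_mul]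
      congr 2; field_simp
    have e2 : |a| ^ q * |t / a| ^ q = |t| ^ q := by
      rw [← Real.mul_rpow (abs_nonneg _) (abs_nonneg _), ← abs_mul]
      congr 2; field_simp
    have e3 : |a| ^ q * |t / a| ^ p = |a| ^ (q - p) * |t| ^ p := by
      rw [abs_div, Real.div_rpow (abs_nonneg _) (abs_nonneg _), Real.rpow_sub ha']
      field_simp
    calc |a + t| ^ q = |a| ^ q * |1 + t / a| ^ q := e1.symm
      _ ≤ |a| ^ q * (1 + q * (t / a) + C * (|t / a| ^ p + |t / a| ^ q)) := h
      _ = |a| ^ q + |a| ^ q * q / a * t +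
          C * (|a| ^ q * |t / a| ^ p + |a| ^ q * |t / a| ^ q) := by ring
      _ = _ := by rw [e2, e3]

/-- It allows a `κ`-th root that keeps coefficient `1` on `P`: each of the three terms is at most
`P`, `C M` or `C M` times `(P + 2 C M) ^ (κ - 1)`. -/
lemma rpow_add_mul_le {κ C P M : ℝ} (hκ : 1 < κ) (hC : 1 ≤ C) (hP : 0 ≤ P) (hM : 0 ≤ M) :
    P ^ κ + C * (P ^ (κ - 1) * M + M ^ κ) ≤ (P + 2 * C * M) ^ κ := by
  have hsplit : ∀ x : ℝ, 0 ≤ x → x ^ κ = x * x ^ (κ - 1) := fun x hx => by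
    rw [← Real.rpow_one_add' hx (by linarith)]; ring_nf
  have hS : 0 ≤ P + 2 * C * M := by positivity
  rw [hsplit _ hS, hsplit P hP, hsplit M hM]
  have h1 : P ^ (κ - 1) ≤ (P + 2 * C * M) ^ (κ - 1) :=
    Real.rpow_le_rpow hP (by nlinarith) (by linarith)
  have h2 : M ^ (κ - 1) ≤ (P + 2 * C * M) ^ (κ - 1) :=
    Real.rpow_le_rpow hM (by nlinarith) (by linarith)
  have hCM : 0 ≤ C * M := by positivity
  nlinarith [mul_le_mul_of_nonneg_left h1 hP, mul_le_mul_of_nonneg_left h1 hCM,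
    mul_le_mul_of_nonneg_left h2 hCM]

lemma integral_abs_rpow_le_rpow {X : Type*} [MeasurableSpace X] {μ : Measure X} [IsFiniteMeasure μ]
    {p κ : ℝ} (hp : 0 < p) (hκ : 1 < κ) {v : X → ℝ} (hv : MemLp v (ENNReal.ofReal (κ * p)) μ) :
    ∫ x, |v x| ^ p ∂μ ≤
      (∫ x, |v x| ^ (κ * p) ∂μ) ^ (1 / κ) * μ.real Set.univ ^ (1 - 1 / κ) := by
  have hκ0 : 0 < κ := by linarith
  have hκ1 : 1 / κ < 1 := by rw [div_lt_one hκ0]; exact hκ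
  have h := lintegral_le_rpow_mul_measure (ν := μ) hκ (hv.1.enorm.pow_const p)
  simp_rw [← ENNReal.rpow_mul, mul_comm p κ] at h
  have hfin := ((memLp_ofReal_iff (by positivity)).1 hv).2
  have := ENNReal.toReal_mono (ENNReal.mul_ne_top
    (ENNReal.rpow_ne_top_of_nonneg (by positivity) hfin)
    (ENNReal.rpow_ne_top_of_nonneg (by linarith) (measure_ne_top _ _))) h
  rw [ENNReal.toReal_mul, ← ENNReal.toReal_rpow, ← ENNReal.toReal_rpow,
    ← integral_abs_rpow_eq_toReal hp hv.1, ← integral_abs_rpow_eq_toReal (by positivity) hv.1]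
    at this
  exact this

/-- For `p ≤ 2`, the `L^q` norm is controlled by the mean with the sharp constant and by the
oscillation. -/
lemma rpow_integral_le_of_le_two {X : Type*} [MeasurableSpace X] {μ : Measure X}
    [IsFiniteMeasure μ] (hμ : 0 < μ.real Set.univ) {p κ : ℝ} (hp : 1 < p) (hp2 : p ≤ 2)
    (hκ : 1 < κ) :
    ∃ C : ℝ, 0 < C ∧ ∀ u : X → ℝ, MemLp u (ENNReal.ofReal (κ * p)) μ →
      (∫ x, |u x| ^ (κ * p) ∂μ) ^ (1 / κ) ≤
        |⨍ y, u y ∂μ| ^ p * μ.real Set.univ ^ (1 / κ) +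
          C * (∫ x, |u x - ⨍ y, u y ∂μ| ^ (κ * p) ∂μ) ^ (1 / κ) := by
  have hp0 : 0 < p := by linarith
  have hκ0 : 0 < κ := by linarith
  have hq : 1 < κ * p := by nlinarith
  have hq0 : 0 < κ * p := by linarith
  obtain ⟨C, hC, hCC⟩ := abs_add_rpow_le hp0 hp2 hq (by nlinarith : p < κ * p)
  refine ⟨2 * C, by linarith, fun u hu => ?_⟩
  set a := ⨍ y, u y ∂μ with ha
  set W := μ.real Set.univ with hW
  obtain ⟨b, hb⟩ := hCC a
  have hv : MemLp (fun x => u x - a) (ENNReal.ofReal (κ * p)) μ := hu.sub (memLp_const a)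
  have hvp : MemLp (fun x => u x - a) (ENNReal.ofReal p) μ :=
    memLp_ofReal_mono (by nlinarith) hv
  have hu1 : Integrable u μ := integrable_of_memLp_ofReal hq.le hu
  have hv1 : Integrable (fun x => u x - a) μ := hu1.sub (integrable_const a)
  have iq := integrable_abs_rpow hq0 hv
  have ip := integrable_abs_rpow hp0 hvp
  have hmean : ∫ x, (u x - a) ∂μ = 0 := by
    rw [integral_sub hu1 (integrable_const a), integral_const, smul_eq_mul, ha, average_eq,
      smul_eq_mul, ← hW, mul_inv_cancel_left₀ hμ.ne', sub_self]
  set N := ∫ x, |u x - a| ^ (κ * p) ∂μ with hN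
  have hN0 : 0 ≤ N := integral_nonneg fun x => by positivity
  have hI : ∫ x, |u x| ^ (κ * p) ∂μ ≤ |a| ^ (κ * p) * W +
      C * (|a| ^ (κ * p - p) * ∫ x, |u x - a| ^ p ∂μ + N) := by
    have i1 : Integrable (fun x => |a| ^ (κ * p) + b * (u x - a)) μ :=
      (integrable_const _).add (hv1.const_mul b)
    have i2 : Integrable (fun x => |a| ^ (κ * p - p) * |u x - a| ^ p + |u x - a| ^ (κ * p)) μ :=
      (ip.const_mul _).add iq
    have i3 := i2.const_mul C
    have h1 : ∫ x, |u x| ^ (κ * p) ∂μ ≤ ∫ x, (|a| ^ (κ * p) + b * (u x - a) +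
        C * (|a| ^ (κ * p - p) * |u x - a| ^ p + |u x - a| ^ (κ * p))) ∂μ := by
      refine integral_mono (integrable_abs_rpow hq0 hu) (i1.add i3) fun x => ?_
      have := hb (u x - a)
      rwa [add_sub_cancel] at this
    refine h1.trans (le_of_eq ?_)
    rw [integral_add i1 i3, integral_add (integrable_const _) (hv1.const_mul b),
      integral_const_mul, integral_const_mul, integral_add (ip.const_mul _) iq, integral_const_mul,
      hmean, integral_const, smul_eq_mul]
    ring
  have hM : ∫ x, |u x - a| ^ p ∂μ ≤ N ^ (1 / κ) * W ^ (1 - 1 / κ) :=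
    integral_abs_rpow_le_rpow hp0 hκ hv
  -- With this `P` and `M = N ^ (1 / κ)`, the bound `hI` combined with Hölder `hM` is the left side
  -- of `rpow_add_mul_le`.
  set P := |a| ^ p * W ^ (1 / κ) with hP
  have hP0 : 0 ≤ P := by positivity
  have e1 : P ^ κ = |a| ^ (κ * p) * W := by
    rw [hP, Real.mul_rpow (by positivity) (by positivity), ← Real.rpow_mul (abs_nonneg _),
      ← Real.rpow_mul hμ.le, one_div_mul_cancel hκ0.ne', Real.rpow_one, mul_comm p]
  have e2 : P ^ (κ - 1) = |a| ^ (κ * p - p) * W ^ (1 - 1 / κ) := by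
    rw [hP, Real.mul_rpow (by positivity) (by positivity), ← Real.rpow_mul (abs_nonneg _),
      ← Real.rpow_mul hμ.le]
    congr 2
    · ring
    · field_simp
  have e3 : (N ^ (1 / κ)) ^ κ = N := by
    rw [← Real.rpow_mul hN0, one_div_mul_cancel hκ0.ne', Real.rpow_one]
  have hkey : ∫ x, |u x| ^ (κ * p) ∂μ ≤ (P + 2 * C * N ^ (1 / κ)) ^ κ := by
    refine le_trans ?_ (rpow_add_mul_le hκ hC hP0 (by positivity : 0 ≤ N ^ (1 / κ)))
    rw [e1, e2, e3]
    refine hI.trans ?_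
    have : |a| ^ (κ * p - p) * ∫ x, |u x - a| ^ p ∂μ ≤
        |a| ^ (κ * p - p) * W ^ (1 - 1 / κ) * N ^ (1 / κ) := by
      rw [mul_assoc, mul_comm (W ^ (1 - 1 / κ))]
      gcongr
    gcongr
  have h4 := Real.rpow_le_rpow (integral_nonneg fun x => by positivity) hkey
    (by positivity : 0 ≤ 1 / κ)
  rwa [← Real.rpow_mul (by positivity), mul_one_div_cancel hκ0.ne', Real.rpow_one] at h4

/-! ### Convexity inequalities and the violation for `p > 2` -/

/-- Convexity at `x / l` and `y / (1 - l)` with weights `l` and `1 - l`. The factor `l ^ (1 - p)`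
tends to `1` as `l → 1`. -/
lemma add_rpow_le_convex {p l x y : ℝ} (hp : 1 ≤ p) (hl0 : 0 < l) (hl1 : l < 1) (hx : 0 ≤ x)
    (hy : 0 ≤ y) : (x + y) ^ p ≤ l ^ (1 - p) * x ^ p + (1 - l) ^ (1 - p) * y ^ p := by
  have hl' : 0 < 1 - l := by linarith
  have h := (convexOn_rpow hp).2 (Set.mem_Ici.2 (by positivity : 0 ≤ x / l))
    (Set.mem_Ici.2 (by positivity : 0 ≤ y / (1 - l))) hl0.le hl'.le (by ring)
  simp only [smul_eq_mul] at h
  rw [mul_div_cancel₀ _ hl0.ne', mul_div_cancel₀ _ hl'.ne', Real.div_rpow hx hl0.le,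
    Real.div_rpow hy hl'.le] at h
  rw [Real.rpow_sub hl0, Real.rpow_sub hl', Real.rpow_one, Real.rpow_one]
  refine h.trans (le_of_eq ?_)
  ring

/-- A quantitative Bernoulli inequality. -/
lemma one_add_mul_add_sq_le_rpow {κ t : ℝ} (hκ : 1 < κ) (ht : |t| ≤ 1 / 2) :
    1 + κ * t + (κ - 1) / 9 * t ^ 2 ≤ (1 + t) ^ κ := by
  have ⟨ht1, ht2⟩ := abs_le.1 ht
  have hpos : 0 < 1 + t := by linarith
  -- The bound `log y ≥ 1 - 1/y` at the square root yields `(1 + t) log (1 + t) ≥ t + (y - 1)²`, and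
  -- `t = (y - 1)(y + 1)` with `y + 1 ≤ 3` makes the square at least `t² / 9`. Applied at `1 + t`
  -- itself it would give no quadratic gain.
  set y := √(1 + t) with hy
  have hy0 : 0 < y := Real.sqrt_pos.2 hpos
  have hyy : y ^ 2 = 1 + t := Real.sq_sqrt hpos.le
  have hy2 : y ≤ 2 := by nlinarith
  have hlog : 1 - y⁻¹ ≤ Real.log y := Real.one_sub_inv_le_log_of_pos hy0
  have hlog2 : Real.log (1 + t) = 2 * Real.log y := by
    rw [← hyy, Real.log_pow]; norm_num
  have h1 : (1 + t) * (2 * (1 - y⁻¹)) ≤ (1 + t) * Real.log (1 + t) := by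
    rw [hlog2]; gcongr
  have h2 : (1 + t) * (2 * (1 - y⁻¹)) = t + (y - 1) ^ 2 := by
    rw [← hyy]
    have : y ^ 2 * (2 * (1 - y⁻¹)) = 2 * y ^ 2 - 2 * y := by field_simp
    rw [this]; linear_combination hyy
  have h3 : t ^ 2 ≤ 9 * (y - 1) ^ 2 := by
    have : t = (y - 1) * (y + 1) := by linear_combination -hyy
    rw [this, mul_pow]
    nlinarith [sq_nonneg (y - 1),
      mul_nonneg (sq_nonneg (y - 1)) (by nlinarith : 0 ≤ 9 - (y + 1) ^ 2)]
  have h4 : 1 + (κ - 1) * Real.log (1 + t) ≤ (1 + t) ^ (κ - 1) := by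
    rw [Real.rpow_def_of_pos hpos]
    have := Real.add_one_le_exp (Real.log (1 + t) * (κ - 1))
    linarith
  have h5 : (1 + t) ^ κ = (1 + t) * (1 + t) ^ (κ - 1) := by
    rw [← Real.rpow_one_add' hpos.le (by linarith)]; ring_nf
  rw [h5]
  have h6 := mul_le_mul_of_nonneg_left h4 hpos.le
  have h7 : t + t ^ 2 / 9 ≤ (1 + t) * Real.log (1 + t) := by linarith
  have h8 := mul_le_mul_of_nonneg_left h7 (by linarith : 0 ≤ κ - 1)
  nlinarith

/-- The chord of a convex function over `[1, 2]`. -/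
lemma one_add_rpow_le {κ y : ℝ} (hκ : 1 ≤ κ) (h0 : 0 ≤ y) (h1 : y ≤ 1) :
    (1 + y) ^ κ ≤ 1 + (2 ^ κ - 1) * y := by
  have h := (convexOn_rpow hκ).2 (Set.mem_Ici.2 (zero_le_one' ℝ))
    (Set.mem_Ici.2 (zero_le_two (α := ℝ))) (by linarith : 0 ≤ 1 - y) h0 (by ring)
  simp only [smul_eq_mul, Real.one_rpow] at h
  have e : (1 - y) * 1 + y * 2 = 1 + y := by ring
  rw [e] at h
  linarith

/-- For `p > 2`, perturbations `(1 + ε φ)^{1/p}` of the constant function violate every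
inequality with the sharp constant. -/
lemma exists_violation {X : Type*} [MeasurableSpace X] {μ : Measure X} [IsFiniteMeasure μ]
    (hμ : 0 < μ.real Set.univ) {d : X → X → ℝ} (hd : ∀ x y, 0 ≤ d x y) {p κ e : ℝ} (hp : 2 < p)
    (hκ : 1 < κ) {φ : X → ℝ} (hφm : Measurable φ) (hφb : ∃ S, ∀ x, |φ x| ≤ S)
    (hφ0 : ∫ x, φ x ∂μ = 0)
    (hφ2 : 0 < ∫ x, φ x ^ 2 ∂μ) (hE : energy μ d p e φ ≠ ∞) (A : ℝ) :
    ∃ u : X → ℝ, Measurable u ∧ (∀ x, |u x| ≤ 2) ∧ energy μ d p e u ≠ ∞ ∧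
      A * (energy μ d p e u).toReal + μ.real Set.univ ^ (1 / κ - 1) * ∫ x, |u x| ^ p ∂μ <
        (∫ x, |u x| ^ (κ * p) ∂μ) ^ (1 / κ) := by
  have hp0 : 0 < p := by linarith
  have hκ0 : 0 < κ := by linarith
  obtain ⟨S, hS⟩ := hφb
  set W := μ.real Set.univ with hW
  set m := ∫ x, φ x ^ 2 ∂μ with hm
  obtain ⟨L, hL, hLL⟩ := exists_abs_rpow_sub_le (1 / p)
  set EE := (energy μ d p e φ).toReal with hEE
  -- Normalised so that the energy term is at most `W ^ (1 / κ) * (D * ε ^ p)`; the right side of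
  -- the inequality is then at most `W ^ (1 / κ) * (1 + D ε ^ p)`.
  set D := |A| * L ^ p * EE * W ^ (-(1 / κ)) with hD
  have hD0 : 0 ≤ D := by positivity
  have hex : ∃ ε : ℝ, 0 < ε ∧ ε * S ≤ 1 / 2 ∧ D * ε ^ p ≤ 1 ∧
      (2 ^ κ - 1) * (D * ε ^ p) < (κ - 1) / 9 * (m / W) * ε ^ 2 := by
    have t0 : Tendsto (fun ε : ℝ => ε * S) (𝓝[>] 0) (𝓝 0) := by
      have : Tendsto (fun ε : ℝ => ε * S) (𝓝 0) (𝓝 (0 * S)) := tendsto_id.mul_const S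
      rw [zero_mul] at this
      exact this.mono_left nhdsWithin_le_nhds
    have t1 : ∀ r : ℝ, 0 < r → ∀ B : ℝ, Tendsto (fun ε : ℝ => B * ε ^ r) (𝓝[>] 0) (𝓝 0) := by
      intro r hr B
      have : Tendsto (fun ε : ℝ => B * ε ^ r) (𝓝 0) (𝓝 (B * 0 ^ r)) :=
        ((Real.continuousAt_rpow_const 0 r (Or.inr hr.le)).tendsto).const_mul B
      rw [Real.zero_rpow hr.ne', mul_zero] at this
      exact this.mono_left nhdsWithin_le_nhds
    have hc : 0 < (κ - 1) / 9 * (m / W) := by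
      have : 0 < κ - 1 := by linarith
      positivity
    have ev := ((t0.eventually_le_const (by norm_num : (0 : ℝ) < 1 / 2)).and
      ((t1 p hp0 D).eventually_le_const one_pos)).and
      (((t1 (p - 2) (by linarith) ((2 ^ κ - 1) * D)).eventually_lt_const hc).and
        self_mem_nhdsWithin)
    obtain ⟨ε, ⟨h1, h2⟩, h3, h4⟩ := ev.exists
    have h4' : 0 < ε := h4
    refine ⟨ε, h4', h1, h2, ?_⟩
    -- Here `p > 2` decides: the energy is of smaller order than the quadratic gain.
    have h5 : ε ^ p = ε ^ (p - 2) * ε ^ 2 := by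
      rw [← Real.rpow_two, ← Real.rpow_add h4']; ring_nf
    rw [h5]
    have := mul_lt_mul_of_pos_right h3 (by positivity : 0 < ε ^ 2)
    linarith
  obtain ⟨ε, hε, hεS, hε1, hε2⟩ := hex
  have hb : ∀ x, |ε * φ x| ≤ 1 / 2 := fun x => by
    rw [abs_mul, abs_of_pos hε]
    exact (mul_le_mul_of_nonneg_left (hS x) hε.le).trans hεS
  have hIcc : ∀ x, 1 + ε * φ x ∈ Set.Icc (1 / 2 : ℝ) (3 / 2) := fun x => by
    have ⟨h1, h2⟩ := abs_le.1 (hb x)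
    exact ⟨by linarith, by linarith⟩
  have hpos : ∀ x, 0 < 1 + ε * φ x := fun x => by linarith [(hIcc x).1]
  -- The `p`-th root makes `|u| ^ p` affine in `φ`, so the `L^p` norm does not change at all.
  set u : X → ℝ := fun x => (1 + ε * φ x) ^ (1 / p) with hu
  have hu0 : ∀ x, 0 < u x := fun x => Real.rpow_pos_of_pos (hpos x) _
  have hum : Measurable u := (measurable_const.add (hφm.const_mul ε)).pow_const _
  have hup : ∀ x, |u x| ^ p = 1 + ε * φ x := fun x => by
    rw [abs_of_pos (hu0 x), hu, ← Real.rpow_mul (hpos x).le, one_div_mul_cancel hp0.ne',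
      Real.rpow_one]
  have huq : ∀ x, |u x| ^ (κ * p) = (1 + ε * φ x) ^ κ := fun x => by
    rw [mul_comm, Real.rpow_mul (abs_nonneg _), hup]
  have hEu : energy μ d p e u ≤ ENNReal.ofReal ((L * ε) ^ p) * energy μ d p e φ := by
    have hle : ∀ x y, ENNReal.ofReal (|u x - u y| ^ p / d x y ^ e) ≤
        ENNReal.ofReal ((L * ε) ^ p) * ENNReal.ofReal (|φ x - φ y| ^ p / d x y ^ e) := fun x y => by
      rw [← ENNReal.ofReal_mul (by positivity)]
      refine ENNReal.ofReal_le_ofReal ?_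
      have hdn := hd x y
      rw [mul_div_assoc', ← Real.mul_rpow (by positivity) (abs_nonneg _)]
      have h1 := hLL _ (hIcc x) _ (hIcc y)
      have e1 : (1 + ε * φ x) - (1 + ε * φ y) = ε * (φ x - φ y) := by ring
      rw [e1, abs_mul, abs_of_pos hε, ← mul_assoc] at h1
      gcongr
    calc energy μ d p e u ≤ ∫⁻ x, ∫⁻ y, ENNReal.ofReal ((L * ε) ^ p) *
          ENNReal.ofReal (|φ x - φ y| ^ p / d x y ^ e) ∂μ ∂μ :=
          lintegral_mono fun x => lintegral_mono fun y => hle x y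
      _ = _ := by
          simp_rw [lintegral_const_mul' _ _ ENNReal.ofReal_ne_top]
          rfl
  have hEutop := ENNReal.mul_ne_top (ENNReal.ofReal_ne_top (r := (L * ε) ^ p)) hE
  have hEur : (energy μ d p e u).toReal ≤ (L * ε) ^ p * EE := by
    have := ENNReal.toReal_mono hEutop hEu
    rwa [ENNReal.toReal_mul, ENNReal.toReal_ofReal (by positivity)] at this
  have iφ : Integrable φ μ := by
    refine Integrable.of_bound hφm.aestronglyMeasurable S (Eventually.of_forall fun x => ?_)
    exact hS x
  have iφ2 : Integrable (fun x => φ x ^ 2) μ := by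
    refine Integrable.of_bound (hφm.pow_const 2).aestronglyMeasurable (S ^ 2)
      (Eventually.of_forall fun x => ?_)
    rw [norm_pow]
    exact pow_le_pow_left₀ (norm_nonneg _) (hS x) 2
  have hIp : ∫ x, |u x| ^ p ∂μ = W := by
    simp_rw [hup]
    rw [integral_add (integrable_const _) (iφ.const_mul ε), integral_const_mul, hφ0,
      integral_const, smul_eq_mul]
    ring
  have hIq : W * (1 + (κ - 1) / 9 * (m / W) * ε ^ 2) ≤ ∫ x, |u x| ^ (κ * p) ∂μ := by
    simp_rw [huq]
    have i1 : Integrable (fun x => 1 + κ * (ε * φ x)) μ :=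
      (integrable_const _).add ((iφ.const_mul ε).const_mul κ)
    have i2 : Integrable (fun x => (κ - 1) / 9 * ε ^ 2 * φ x ^ 2) μ := iφ2.const_mul _
    have h1 : ∫ x, (1 + κ * (ε * φ x) + (κ - 1) / 9 * ε ^ 2 * φ x ^ 2) ∂μ ≤
        ∫ x, (1 + ε * φ x) ^ κ ∂μ := by
      refine integral_mono (i1.add i2) ?_ fun x => ?_
      · refine Integrable.of_bound
          ((measurable_const.add (hφm.const_mul ε)).pow_const κ).aestronglyMeasurable (2 ^ κ)
          (Eventually.of_forall fun x => ?_)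
        rw [Real.norm_eq_abs, abs_of_nonneg (Real.rpow_nonneg (hpos x).le _)]
        exact Real.rpow_le_rpow (hpos x).le (by linarith [(hIcc x).2]) hκ0.le
      · have := one_add_mul_add_sq_le_rpow hκ (hb x)
        rw [mul_pow, ← mul_assoc ((κ - 1) / 9)] at this
        exact this
    refine le_trans (le_of_eq ?_) h1
    rw [integral_add i1 i2, integral_add (integrable_const _) ((iφ.const_mul ε).const_mul κ),
      integral_const_mul, integral_const_mul, integral_const_mul, hφ0, integral_const, smul_eq_mul]
    field_simp
    ring
  refine ⟨u, hum, fun x => ?_, ne_top_of_le_ne_top hEutop hEu, ?_⟩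
  · rw [abs_of_pos (hu0 x)]
    calc u x ≤ (2 : ℝ) ^ (1 / p) :=
          Real.rpow_le_rpow (hpos x).le (by linarith [(hIcc x).2]) (by positivity)
      _ ≤ 2 ^ (1 : ℝ) := by
          refine Real.rpow_le_rpow_of_exponent_le (by norm_num) ?_
          rw [div_le_one hp0]; linarith
      _ = 2 := by norm_num
  · rw [hIp]
    have e1 : W ^ (1 / κ - 1) * W = W ^ (1 / κ) := by
      rw [← Real.rpow_add_one hμ.ne']; ring_nf
    rw [e1]
    set Y := D * ε ^ p with hY
    have hY0 : 0 ≤ Y := by positivity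
    have h1 : A * (energy μ d p e u).toReal + W ^ (1 / κ) ≤ W ^ (1 / κ) * (1 + Y) := by
      have h2 : A * (energy μ d p e u).toReal ≤ |A| * ((L * ε) ^ p * EE) :=
        mul_le_mul (le_abs_self A) hEur ENNReal.toReal_nonneg (abs_nonneg A)
      have h3 : W ^ (1 / κ) * Y = |A| * ((L * ε) ^ p * EE) := by
        rw [hY, hD, Real.mul_rpow hL.le hε.le, Real.rpow_neg hμ.le]
        have : W ^ (1 / κ) ≠ 0 := by positivity
        field_simp
      linarith
    refine h1.trans_lt ?_
    have h4 : (1 + Y) ^ κ < 1 + (κ - 1) / 9 * (m / W) * ε ^ 2 :=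
      (one_add_rpow_le hκ.le hY0 hε1).trans_lt (by linarith)
    have h5 : W * (1 + Y) ^ κ < ∫ x, |u x| ^ (κ * p) ∂μ :=
      (mul_lt_mul_of_pos_left h4 hμ).trans_le hIq
    have h6 := Real.rpow_lt_rpow (by positivity) h5 (by positivity : 0 < 1 / κ)
    rwa [Real.mul_rpow hμ.le (by positivity), ← Real.rpow_mul (by positivity),
      mul_one_div_cancel hκ0.ne', Real.rpow_one] at h6

/-! ### Finite energy of Lipschitz functions -/

/-- Dyadic decomposition: on the shell `ρ k / 2 ≤ d ≤ ρ k` the integrand is at most `a k`, and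
summing `a k` times the ball volume gives a geometric series of ratio `2 ^ (-(Q + p - e))`. -/
lemma lintegral_kernel_le {X : Type*} [MeasurableSpace X] {μ : Measure X}
    {d : X → X → ℝ} (hdm : ∀ x, Measurable (d x)) (hd0 : ∀ x y, 0 ≤ d x y)
    (hd1 : ∀ x y, d x y = 0 → x = y) {R c Q : ℝ} (hR : 0 < R) (hdR : ∀ x y, d x y ≤ R)
    (hball : ∀ x r, 0 < r → r ≤ R → μ {y | d x y ≤ r} ≤ ENNReal.ofReal (c * r ^ Q))
    {p e L : ℝ} (hp : 0 < p) (he : 0 ≤ e) (hδ : 0 < Q + p - e) (hL : 0 ≤ L) {φ : X → ℝ}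
    (hφ : ∀ x y, |φ x - φ y| ≤ L * d x y) :
    ∃ C : ℝ≥0∞, C ≠ ∞ ∧
      ∀ x, ∫⁻ y, ENNReal.ofReal (|φ x - φ y| ^ p / d x y ^ e) ∂μ ≤ C := by
  set ρ : ℕ → ℝ := fun k => R * (1 / 2) ^ k with hρ
  have hρ0 : ∀ k, 0 < ρ k := fun k => by positivity
  have hρR : ∀ k, ρ k ≤ R := fun k =>
    mul_le_of_le_one_right hR.le (pow_le_one₀ (by norm_num) (by norm_num))
  set a : ℕ → ℝ := fun k => (L * ρ k) ^ p / (ρ k / 2) ^ e with ha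
  have ha0 : ∀ k, 0 ≤ a k := fun k => by have := hρ0 k; positivity
  have hmb : ∀ x k, MeasurableSet {y | d x y ≤ ρ k} := fun x k =>
    measurableSet_le (hdm x) measurable_const
  refine ⟨∑' k, ENNReal.ofReal (a k * (c * ρ k ^ Q)), ?_, fun x => ?_⟩
  · have hform : ∀ k, a k * (c * ρ k ^ Q) =
        (L ^ p * 2 ^ e * c * R ^ (Q + p - e)) * ((1 / 2 : ℝ) ^ (Q + p - e)) ^ k := fun k => by
      have h1 : ((1 / 2 : ℝ) ^ (Q + p - e)) ^ k = ((1 / 2 : ℝ) ^ k) ^ (Q + p - e) := by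
        rw [← Real.rpow_natCast, ← Real.rpow_mul (by norm_num), mul_comm,
          Real.rpow_mul (by norm_num), Real.rpow_natCast]
      have h2 : R ^ (Q + p - e) * ((1 / 2 : ℝ) ^ k) ^ (Q + p - e) = ρ k ^ (Q + p - e) := by
        rw [hρ, Real.mul_rpow hR.le (by positivity)]
      have h3 := hρ0 k
      have hak : a k = (L * ρ k) ^ p / (ρ k / 2) ^ e := rfl
      rw [h1, mul_assoc _ (R ^ _), h2, hak, Real.rpow_sub h3, Real.rpow_add h3,
        Real.mul_rpow hL h3.le, Real.div_rpow h3.le (by norm_num)]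
      field_simp
    have hs : Summable fun k => a k * (c * ρ k ^ Q) := by
      simp_rw [hform]
      refine (summable_geometric_of_lt_one (by positivity) ?_).mul_left _
      exact Real.rpow_lt_one (by norm_num) (by norm_num) hδ
    exact hs.tsum_ofReal_ne_top
  · calc ∫⁻ y, ENNReal.ofReal (|φ x - φ y| ^ p / d x y ^ e) ∂μ
        ≤ ∫⁻ y, ∑' k, {y | d x y ≤ ρ k}.indicator (fun _ => ENNReal.ofReal (a k)) y ∂μ := by
          refine lintegral_mono fun y => ?_
          rcases (hd0 x y).eq_or_lt with h | h
          · have := hd1 x y h.symm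
            rw [this]; simp [Real.zero_rpow hp.ne']
          · obtain ⟨k, hk1, hk2⟩ := exists_nat_pow_near_of_lt_one (x := d x y / R) (y := 1 / 2)
              (by positivity) (by rw [div_le_one hR]; exact hdR x y) (by norm_num) (by norm_num)
            have hk1' : ρ k / 2 ≤ d x y := by
              rw [lt_div_iff₀ hR] at hk1
              have : ρ k / 2 = (1 / 2) ^ (k + 1) * R := by rw [hρ]; ring
              linarith
            have hk2' : d x y ≤ ρ k := by
              rw [div_le_iff₀ hR] at hk2
              have : ρ k = (1 / 2) ^ k * R := by rw [hρ]; ring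
              linarith
            refine le_trans ?_ (ENNReal.le_tsum k)
            rw [Set.indicator_of_mem (by exact hk2')]
            refine ENNReal.ofReal_le_ofReal ?_
            have h1 := hρ0 k
            have h2 : |φ x - φ y| ≤ L * ρ k := (hφ x y).trans (by gcongr)
            simp only [ha]
            gcongr
      _ = ∑' k, ENNReal.ofReal (a k) * μ {y | d x y ≤ ρ k} := by
          rw [lintegral_tsum fun k => (measurable_const.indicator (hmb x k)).aemeasurable]
          refine tsum_congr fun k => ?_
          rw [lintegral_indicator_const (hmb x k)]
      _ ≤ ∑' k, ENNReal.ofReal (a k * (c * ρ k ^ Q)) := by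
          refine ENNReal.tsum_le_tsum fun k => ?_
          rw [ENNReal.ofReal_mul (ha0 k)]
          gcongr
          exact hball x _ (hρ0 k) (hρR k)

lemma energy_ne_top_of_lipschitz {X : Type*} [MeasurableSpace X] {μ : Measure X}
    [IsFiniteMeasure μ] {d : X → X → ℝ} (hdm : ∀ x, Measurable (d x)) (hd0 : ∀ x y, 0 ≤ d x y)
    (hd1 : ∀ x y, d x y = 0 → x = y) {R c Q : ℝ} (hR : 0 < R) (hdR : ∀ x y, d x y ≤ R)
    (hball : ∀ x r, 0 < r → r ≤ R → μ {y | d x y ≤ r} ≤ ENNReal.ofReal (c * r ^ Q))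
    {p e L : ℝ} (hp : 0 < p) (he : 0 ≤ e) (hδ : 0 < Q + p - e) (hL : 0 ≤ L) {φ : X → ℝ}
    (hφ : ∀ x y, |φ x - φ y| ≤ L * d x y) : energy μ d p e φ ≠ ∞ := by
  obtain ⟨C, hC, hCC⟩ := lintegral_kernel_le hdm hd0 hd1 hR hdR hball hp he hδ hL hφ
  refine ne_top_of_le_ne_top (b := C * μ Set.univ)
    (ENNReal.mul_ne_top hC (measure_ne_top _ _)) ?_
  rw [← lintegral_const]
  exact lintegral_mono hCC

/-! ### The threshold in the abstract setting -/

/-- The Sobolev inequality with constants `A` and `B` for all functions of finite energy. -/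
def Admissible {X : Type*} [MeasurableSpace X] (μ : Measure X) (d : X → X → ℝ) (p κ e B : ℝ) :
    Prop :=
  ∃ A : ℝ, ∀ u : X → ℝ, MemLp u (ENNReal.ofReal p) μ → energy μ d p e u ≠ ∞ →
    MemLp u (ENNReal.ofReal (κ * p)) μ ∧
      (∫ x, |u x| ^ (κ * p) ∂μ) ^ (1 / κ) ≤
        A * (energy μ d p e u).toReal + B * ∫ x, |u x| ^ p ∂μ

lemma Admissible.mono {X : Type*} [MeasurableSpace X] {μ : Measure X} {d : X → X → ℝ}
    {p κ e B B' : ℝ} (h : Admissible μ d p κ e B) (hB : B ≤ B') : Admissible μ d p κ e B' := by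
  obtain ⟨A, hA⟩ := h
  refine ⟨A, fun u hu hE => ⟨(hA u hu hE).1, (hA u hu hE).2.trans ?_⟩⟩
  have : 0 ≤ ∫ x, |u x| ^ p ∂μ := integral_nonneg fun x => by positivity
  gcongr

lemma Admissible.le {X : Type*} [MeasurableSpace X] {μ : Measure X} [IsFiniteMeasure μ]
    (hμ : 0 < μ.real Set.univ) {d : X → X → ℝ} {p κ e B : ℝ} (hp : 0 < p)
    (h : Admissible μ d p κ e B) : μ.real Set.univ ^ (1 / κ - 1) ≤ B := by
  obtain ⟨A, hA⟩ := h
  have h0 : energy μ d p e (fun _ => (1 : ℝ)) = 0 := by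
    simp [energy, Real.zero_rpow hp.ne']
  have := (hA (fun _ => 1) (memLp_const 1) (by rw [h0]; simp)).2
  simp only [abs_one, Real.one_rpow, integral_const, smul_eq_mul, mul_one, h0,
    ENNReal.toReal_zero, mul_zero, zero_add] at this
  rw [Real.rpow_sub hμ, Real.rpow_one, div_le_iff₀ hμ]
  exact this

lemma admissible_of_le_two {X : Type*} [MeasurableSpace X] {μ : Measure X} [IsFiniteMeasure μ]
    (hμ : 0 < μ.real Set.univ) {d : X → X → ℝ} {Q R c : ℝ} (H : LowerRegular μ d Q R c)
    {p σ κ : ℝ} (hp : 1 < p) (hp2 : p ≤ 2) (hQ : 0 < Q) (hκ : 1 < κ)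
    (hσ : σ = Q * (1 - 1 / κ)) :
    Admissible μ d p κ (Q + σ) (μ.real Set.univ ^ (1 / κ - 1)) := by
  obtain ⟨K, hK, hKK⟩ := sobolev_poincare hμ H hp hQ hκ hσ
  obtain ⟨C, hC, hCC⟩ := rpow_integral_le_of_le_two hμ hp hp2 hκ
  refine ⟨C * K, fun u hu hE => ?_⟩
  obtain ⟨h1, h2⟩ := hKK u hu hE
  refine ⟨h1, (hCC u h1).trans ?_⟩
  have h3 := abs_average_rpow_le hμ hp hu
  calc |⨍ y, u y ∂μ| ^ p * μ.real Set.univ ^ (1 / κ) +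
        C * (∫ x, |u x - ⨍ y, u y ∂μ| ^ (κ * p) ∂μ) ^ (1 / κ)
      ≤ ((μ.real Set.univ)⁻¹ * ∫ x, |u x| ^ p ∂μ) * μ.real Set.univ ^ (1 / κ) +
        C * (K * (energy μ d p (Q + σ) u).toReal) := by gcongr
    _ = _ := by
        rw [Real.rpow_sub hμ, Real.rpow_one]
        ring

/-- Minkowski in `L^{κp}` separates mean and oscillation; `l` is chosen so that the loss `l ^ (1 -
p)` on the mean is exactly `B / B₀ > 1`. -/
lemma admissible_of_lt {X : Type*} [MeasurableSpace X] {μ : Measure X} [IsFiniteMeasure μ]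
    (hμ : 0 < μ.real Set.univ) {d : X → X → ℝ} {Q R c : ℝ} (H : LowerRegular μ d Q R c)
    {p σ κ B : ℝ} (hp : 1 < p) (hQ : 0 < Q) (hκ : 1 < κ) (hσ : σ = Q * (1 - 1 / κ))
    (hB : μ.real Set.univ ^ (1 / κ - 1) < B) : Admissible μ d p κ (Q + σ) B := by
  have hp0 : 0 < p := by linarith
  have hκ0 : 0 < κ := by linarith
  have hq1 : 1 ≤ κ * p := by nlinarith
  have hq0 : 0 < κ * p := by linarith
  set W := μ.real Set.univ with hW
  set B₀ := W ^ (1 / κ - 1) with hB₀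
  have hB₀0 : 0 < B₀ := by positivity
  have hB0 : 0 < B := hB₀0.trans hB
  obtain ⟨K, hK, hKK⟩ := sobolev_poincare hμ H hp hQ hκ hσ
  obtain ⟨l, hl0, hl1, hlB⟩ : ∃ l : ℝ, 0 < l ∧ l < 1 ∧ l ^ (1 - p) = B / B₀ := by
    refine ⟨(B / B₀) ^ (-(1 / (p - 1))), by positivity, ?_, ?_⟩
    · refine Real.rpow_lt_one_of_one_lt_of_neg (by rwa [one_lt_div hB₀0]) ?_
      have : 0 < 1 / (p - 1) := by rw [one_div_pos]; linarith
      linarith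
    · have : p - 1 ≠ 0 := by linarith
      rw [← Real.rpow_mul (by positivity)]
      have e1 : -(1 / (p - 1)) * (1 - p) = 1 := by field_simp; ring
      rw [e1, Real.rpow_one]
  refine ⟨(1 - l) ^ (1 - p) * K, fun u hu hE => ?_⟩
  obtain ⟨h1, h2⟩ := hKK u hu hE
  refine ⟨h1, ?_⟩
  set a := ⨍ y, u y ∂μ with ha
  have h3 := abs_average_rpow_le hμ hp hu
  rw [← ha, ← hW] at h3
  have hv : MemLp (fun x => u x - a) (ENNReal.ofReal (κ * p)) μ := h1.sub (memLp_const a)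
  have htri : (eLpNorm u (ENNReal.ofReal (κ * p)) μ).toReal ≤
      (eLpNorm (fun _ : X => a) (ENNReal.ofReal (κ * p)) μ).toReal +
        (eLpNorm (fun x => u x - a) (ENNReal.ofReal (κ * p)) μ).toReal := by
    rw [← ENNReal.toReal_add (memLp_const a).2.ne hv.2.ne]
    refine ENNReal.toReal_mono (ENNReal.add_ne_top.2 ⟨(memLp_const a).2.ne, hv.2.ne⟩) ?_
    have := eLpNorm_add_le (μ := μ) (aestronglyMeasurable_const (b := a)) hv.1
      (by simpa using ENNReal.ofReal_le_ofReal hq1 : 1 ≤ ENNReal.ofReal (κ * p))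
    refine le_trans (le_of_eq ?_) this
    congr 1
    ext x
    simp
  have hpow := Real.rpow_le_rpow ENNReal.toReal_nonneg htri hp0.le
  have hconv := add_rpow_le_convex hp.le hl0 hl1
    (ENNReal.toReal_nonneg (a := eLpNorm (fun _ : X => a) (ENNReal.ofReal (κ * p)) μ))
    (ENNReal.toReal_nonneg (a := eLpNorm (fun x => u x - a) (ENNReal.ofReal (κ * p)) μ))
  have hexp : p / (κ * p) = 1 / κ := by field_simp
  rw [toReal_eLpNorm_rpow hq0 p h1.1, hexp] at hpow
  rw [toReal_eLpNorm_rpow hq0 p hv.1, toReal_eLpNorm_rpow hq0 p aestronglyMeasurable_const,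
    hexp] at hconv
  refine (hpow.trans hconv).trans ?_
  have e2 : (∫ _x : X, |a| ^ (κ * p) ∂μ) ^ (1 / κ) = W ^ (1 / κ) * |a| ^ p := by
    rw [integral_const, smul_eq_mul, Real.mul_rpow hμ.le (by positivity),
      ← Real.rpow_mul (abs_nonneg _)]
    congr 2
    field_simp
  rw [e2, hlB]
  calc B / B₀ * (W ^ (1 / κ) * |a| ^ p) +
        (1 - l) ^ (1 - p) * (∫ x, |u x - a| ^ (κ * p) ∂μ) ^ (1 / κ)
      ≤ B / B₀ * (W ^ (1 / κ) * (W⁻¹ * ∫ x, |u x| ^ p ∂μ)) +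
        (1 - l) ^ (1 - p) * (K * (energy μ d p (Q + σ) u).toReal) := by
        have : 0 < 1 - l := by linarith
        gcongr
    _ = _ := by
        have e3 : W ^ (1 / κ) = B₀ * W := by
          rw [hB₀, ← Real.rpow_add_one hμ.ne']; ring_nf
        rw [e3]
        field_simp
        ring

/-- Subtracting the mean keeps the energy, and a function that is not a.e. constant has positive
variance, as `exists_violation` requires. -/
lemma not_admissible_of_two_lt {X : Type*} [MeasurableSpace X] {μ : Measure X}
    [IsFiniteMeasure μ] (hμ : 0 < μ.real Set.univ) {d : X → X → ℝ} (hd : ∀ x y, 0 ≤ d x y)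
    {p κ e : ℝ} (hp : 2 < p) (hκ : 1 < κ) {φ : X → ℝ} (hφm : Measurable φ)
    (hφb : ∃ S, ∀ x, |φ x| ≤ S) (hφc : ∀ m : ℝ, ¬ φ =ᵐ[μ] fun _ => m)
    (hE : energy μ d p e φ ≠ ∞) :
    ¬ Admissible μ d p κ e (μ.real Set.univ ^ (1 / κ - 1)) := by
  rintro ⟨A, hA⟩
  obtain ⟨S, hS⟩ := hφb
  set m := ⨍ x, φ x ∂μ with hm
  have iφ : Integrable φ μ :=
    Integrable.of_bound hφm.aestronglyMeasurable S (Eventually.of_forall hS)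
  have hψm : Measurable fun x => φ x - m := hφm.sub_const m
  have hψS : ∀ x, |φ x - m| ≤ S + |m| := fun x => (abs_sub _ _).trans (by gcongr; exact hS x)
  have iψ2 : Integrable (fun x => (φ x - m) ^ 2) μ := by
    refine Integrable.of_bound (hψm.pow_const 2).aestronglyMeasurable ((S + |m|) ^ 2)
      (Eventually.of_forall fun x => ?_)
    rw [norm_pow]
    exact pow_le_pow_left₀ (norm_nonneg _) (hψS x) 2
  have hψ0 : ∫ x, (φ x - m) ∂μ = 0 := by
    rw [integral_sub iφ (integrable_const m), integral_const, smul_eq_mul, hm, average_eq,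
      smul_eq_mul, mul_inv_cancel_left₀ hμ.ne', sub_self]
  have hψ2 : 0 < ∫ x, (φ x - m) ^ 2 ∂μ := by
    refine lt_of_le_of_ne (integral_nonneg fun x => sq_nonneg _) fun h => hφc m ?_
    have := (integral_eq_zero_iff_of_nonneg (fun x => sq_nonneg _) iψ2).1 h.symm
    filter_upwards [this] with x hx
    have : (φ x - m) ^ 2 = 0 := hx
    exact sub_eq_zero.1 (pow_eq_zero_iff two_ne_zero |>.1 this)
  obtain ⟨u, hum, hub, huE, hlt⟩ := exists_violation hμ hd hp hκ hψm ⟨_, hψS⟩ hψ0 hψ2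
    (by rw [energy_sub_const]; exact hE) A
  have hu : MemLp u (ENNReal.ofReal p) μ :=
    MemLp.of_bound hum.aestronglyMeasurable 2 (Eventually.of_forall hub)
  exact absurd (hA u hu huE).2 (not_le.2 hlt)

/-! ### Real coordinates of a unitary basis -/

lemma real_inner_eq_re (n : ℕ) (u v : Amb n) : inner ℝ u v = (inner ℂ u v).re := by
  simp [PiLp.inner_apply]

/-- The real basis `b₀, i b₀, b₁, i b₁, …` underlying a unitary basis of `ℂⁿ⁺¹`. -/
def realFamily {n : ℕ} (b : OrthonormalBasis (Fin (n + 1)) ℂ (Amb n)) (i : Fin (n + 1) × Fin 2) :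
    Amb n := (![1, Complex.I] i.2 : ℂ) • b i.1

lemma inner_realFamily_zero {n : ℕ} (b : OrthonormalBasis (Fin (n + 1)) ℂ (Amb n)) (j : Fin (n + 1))
    (x : Amb n) : inner ℝ (realFamily b (j, 0)) x = (inner ℂ (b j) x).re := by
  simp [realFamily, real_inner_eq_re]

lemma inner_realFamily_one {n : ℕ} (b : OrthonormalBasis (Fin (n + 1)) ℂ (Amb n)) (j : Fin (n + 1))
    (x : Amb n) : inner ℝ (realFamily b (j, 1)) x = (inner ℂ (b j) x).im := by
  simp [realFamily, real_inner_eq_re]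

lemma orthonormal_realFamily {n : ℕ} (b : OrthonormalBasis (Fin (n + 1)) ℂ (Amb n)) :
    Orthonormal ℝ (realFamily b) := by
  rw [orthonormal_iff_ite]
  rintro ⟨j, e⟩ ⟨k, f⟩
  have hb := orthonormal_iff_ite.1 b.orthonormal j k
  rw [real_inner_eq_re, realFamily, realFamily, inner_smul_left, inner_smul_right, hb]
  fin_cases e <;> fin_cases f <;> by_cases h : j = k <;> simp [h]

/-- The real orthonormal basis of `ℂⁿ⁺¹` underlying a unitary one. -/
def realBasis {n : ℕ} (b : OrthonormalBasis (Fin (n + 1)) ℂ (Amb n)) :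
    OrthonormalBasis (Fin (n + 1) × Fin 2) ℝ (Amb n) :=
  OrthonormalBasis.mkOfOrthogonalEqBot (orthonormal_realFamily b) (by
    rw [Submodule.eq_bot_iff]
    intro x hx
    have h : ∀ i, inner ℝ (realFamily b i) x = 0 := fun i =>
      (Submodule.mem_orthogonal _ _).1 hx _ (Submodule.subset_span ⟨i, rfl⟩)
    have h2 : ∀ j, inner ℂ (b j) x = 0 := fun j => by
      apply Complex.ext
      · rw [← inner_realFamily_zero]; exact h _
      · rw [← inner_realFamily_one]; exact h _
    rw [← b.sum_repr' x]
    simp [h2])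

lemma realBasis_apply {n : ℕ} (b : OrthonormalBasis (Fin (n + 1)) ℂ (Amb n))
    (i : Fin (n + 1) × Fin 2) : realBasis b i = realFamily b i := by
  simp [realBasis]

lemma exists_basis_zero_eq {n : ℕ} (ζ : Sph n) :
    ∃ b : OrthonormalBasis (Fin (n + 1)) ℂ (Amb n), b 0 = ζ := by
  have hζ : ‖(ζ : Amb n)‖ = 1 := by simp
  have ho : Orthonormal ℂ (({0} : Set (Fin (n + 1))).domRestrict
      (fun _ : Fin (n + 1) => (ζ : Amb n))) := by
    rw [orthonormal_iff_ite]
    rintro ⟨i, hi⟩ ⟨j, hj⟩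
    rw [Set.mem_singleton_iff] at hi hj
    subst hi; subst hj
    simp [Set.domRestrict, inner_self_eq_norm_sq_to_K, hζ]
  obtain ⟨b, hb⟩ := ho.exists_orthonormalBasis_extension_of_card_eq (by simp)
  exact ⟨b, hb 0 rfl⟩

lemma volume_box {ι E : Type*} [Fintype ι] [NormedAddCommGroup E] [InnerProductSpace ℝ E]
    [FiniteDimensional ℝ E] [MeasurableSpace E] [BorelSpace E] (B : OrthonormalBasis ι ℝ E)
    (l u : ι → ℝ) :
    volume {x : E | ∀ i, inner ℝ (B i) x ∈ Set.Icc (l i) (u i)} =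
      ∏ i, ENNReal.ofReal (u i - l i) := by
  have h := (PiLp.volume_preserving_ofLp (ι := ι)).comp B.measurePreserving_repr
  rw [← Real.volume_Icc_pi, ← h.measure_preimage measurableSet_Icc.nullMeasurableSet]
  congr 1
  ext x
  simp [Set.mem_Icc, Pi.le_def, forall_and, B.repr_apply_apply]

lemma norm_sq_eq_sum {n : ℕ} (b : OrthonormalBasis (Fin (n + 1)) ℂ (Amb n)) (x : Amb n) :
    ‖x‖ ^ 2 = (inner ℂ (b 0) x).re ^ 2 + (inner ℂ (b 0) x).im ^ 2 +
      ∑ j : Fin n, ((inner ℂ (b j.succ) x).re ^ 2 + (inner ℂ (b j.succ) x).im ^ 2) := by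
  rw [← (realBasis b).sum_sq_norm_inner_right x, Fintype.sum_prod_type, Fin.sum_univ_succ]
  simp only [Fin.sum_univ_two, realBasis_apply, inner_realFamily_zero, inner_realFamily_one,
    Real.norm_eq_abs, sq_abs]

/-! ### Surface measure of gauge balls -/

lemma continuous_gauge_right (n : ℕ) (ζ : Sph n) : Continuous fun η => gauge n ζ η := by
  unfold gauge
  fun_prop

lemma gauge_sq (n : ℕ) (ζ η : Sph n) :
    gauge n ζ η ^ 2 = ‖1 - inner ℂ (ζ : Amb n) (η : Amb n)‖ :=
  Real.sq_sqrt (norm_nonneg _)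

lemma gauge_nonneg (n : ℕ) (ζ η : Sph n) : 0 ≤ gauge n ζ η := Real.sqrt_nonneg _

lemma gauge_le_iff (n : ℕ) (ζ η : Sph n) {r : ℝ} (hr : 0 ≤ r) :
    gauge n ζ η ≤ r ↔ ‖1 - inner ℂ (ζ : Amb n) (η : Amb n)‖ ≤ r ^ 2 := by
  rw [gauge, Real.sqrt_le_left hr]

lemma measurableSet_gauge_le (n : ℕ) (ζ : Sph n) (r : ℝ) :
    MeasurableSet {η | gauge n ζ η ≤ r} :=
  measurableSet_le (continuous_gauge_right n ζ).measurable
    measurable_const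

lemma norm_inner_sphere_le {n : ℕ} (ζ η : Sph n) : ‖inner ℂ (ζ : Amb n) (η : Amb n)‖ ≤ 1 := by
  have h := norm_inner_le_norm (𝕜 := ℂ) (ζ : Amb n) (η : Amb n)
  simpa using h

lemma gauge_le_two (n : ℕ) (ζ η : Sph n) : gauge n ζ η ≤ 2 := by
  rw [gauge_le_iff n ζ η (by norm_num)]
  have h := norm_inner_sphere_le ζ η
  have := norm_sub_le (1 : ℂ) (inner ℂ (ζ : Amb n) (η : Amb n))
  rw [norm_one] at this
  linarith

/-- Surface measure is the real dimension times the volume of the cone over the set. This cone fits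
in a box with one side of order `1` (radial), one of order `r²` (the direction `iζ`) and `2n` of
order `r`. -/
lemma toSphere_gauge_ball_le (n : ℕ) : ∃ C : ℝ, 0 < C ∧ ∀ (ζ : Sph n) (r : ℝ), 0 < r →
    (volume : Measure (Amb n)).toSphere {η | gauge n ζ η ≤ r} ≤
      ENNReal.ofReal (C * r ^ homDim n) := by
  set D := Module.finrank ℝ (Amb n)
  refine ⟨(D + 1) * (2 * 2 * ((2 * √2) * (2 * √2)) ^ n), by positivity, fun ζ r hr => ?_⟩
  obtain ⟨b, hb⟩ := exists_basis_zero_eq ζ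
  rw [Measure.toSphere_apply' _ (measurableSet_gauge_le n ζ r)]
  set h : Fin (n + 1) × Fin 2 → ℝ :=
    fun i => if i.1 = 0 then (if i.2 = 0 then 1 else r ^ 2) else √2 * r with hh
  have hsub : Set.Ioo (0 : ℝ) 1 • ((↑) '' {η : Sph n | gauge n ζ η ≤ r}) ⊆
      {x : Amb n | ∀ i, inner ℝ (realBasis b i) x ∈ Set.Icc (-h i) (h i)} := by
    rintro _ ⟨t, ⟨ht0, ht1⟩, _, ⟨η, hη, rfl⟩, rfl⟩
    have hη' := (gauge_le_iff n ζ η hr.le).1 hη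
    have hw := norm_inner_sphere_le ζ η
    rw [← hb] at hη' hw
    set w := inner ℂ (b 0) (η : Amb n) with hwdef
    have hη1 : ‖(η : Amb n)‖ = 1 := by simp
    have hns := norm_sq_eq_sum b (η : Amb n)
    rw [hη1, ← hwdef] at hns
    have hwsq : ‖w‖ ^ 2 = w.re ^ 2 + w.im ^ 2 := by
      rw [← Complex.normSq_eq_norm_sq, Complex.normSq_apply]; ring
    have hw1 : 1 - ‖w‖ ≤ r ^ 2 := by
      have := norm_sub_norm_le (1 : ℂ) w
      rw [norm_one] at this
      linarith
    -- The sum equals `1 - ‖w‖² = (1 - ‖w‖)(1 + ‖w‖)`, and the second factor is at most `2`.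
    have hothers : ∑ j : Fin n, ((inner ℂ (b j.succ) (η : Amb n)).re ^ 2 +
        (inner ℂ (b j.succ) (η : Amb n)).im ^ 2) ≤ 2 * r ^ 2 := by
      nlinarith [norm_nonneg w]
    have hj : ∀ j : Fin n, (inner ℂ (b j.succ) (η : Amb n)).re ^ 2 +
        (inner ℂ (b j.succ) (η : Amb n)).im ^ 2 ≤ (√2 * r) ^ 2 := fun j => by
      rw [mul_pow, Real.sq_sqrt (by norm_num)]
      exact (Finset.single_le_sum (f := fun j : Fin n => (inner ℂ (b j.succ) (η : Amb n)).re ^ 2 +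
        (inner ℂ (b j.succ) (η : Amb n)).im ^ 2) (fun i _ => by positivity)
        (Finset.mem_univ j)).trans hothers
    have hbound : ∀ i, |inner ℝ (realBasis b i) (η : Amb n)| ≤ h i := by
      rintro ⟨j, e⟩
      rw [realBasis_apply]
      induction j using Fin.cases with
      | zero =>
        fin_cases e
        · change |inner ℝ (realFamily b (0, 0)) (η : Amb n)| ≤ _
          rw [inner_realFamily_zero]
          simpa [hh] using (Complex.abs_re_le_norm w).trans hw
        · change |inner ℝ (realFamily b (0, 1)) (η : Amb n)| ≤ _
          rw [inner_realFamily_one]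
          have := (Complex.abs_im_le_norm (1 - w)).trans hη'
          simpa [hh] using this
      | succ j =>
        have hs : 0 ≤ √2 * r := by positivity
        fin_cases e
        · change |inner ℝ (realFamily b (j.succ, 0)) (η : Amb n)| ≤ _
          rw [inner_realFamily_zero]
          simp only [hh, Fin.succ_ne_zero, if_false]
          exact abs_le_of_sq_le_sq
            (by linarith [hj j, sq_nonneg (inner ℂ (b j.succ) (η : Amb n)).im]) hs
        · change |inner ℝ (realFamily b (j.succ, 1)) (η : Amb n)| ≤ _
          rw [inner_realFamily_one]
          simp only [hh, Fin.succ_ne_zero, if_false]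
          exact abs_le_of_sq_le_sq
            (by linarith [hj j, sq_nonneg (inner ℂ (b j.succ) (η : Amb n)).re]) hs
    intro i
    rw [Set.mem_Icc, ← abs_le]
    change |inner ℝ (realBasis b i) (t • (η : Amb n))| ≤ h i
    rw [inner_smul_right, abs_mul, abs_of_pos ht0]
    nlinarith [hbound i, abs_nonneg (inner ℝ (realBasis b i) (η : Amb n))]
  have hvol := measure_mono (μ := volume) hsub
  rw [volume_box] at hvol
  have hprod : ∏ i, ENNReal.ofReal (h i - -h i) =
      ENNReal.ofReal (2 * 2 * ((2 * √2) * (2 * √2)) ^ n * r ^ homDim n) := by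
    have hh0 : ∀ i, 0 ≤ h i := fun i => by
      simp only [hh]; split_ifs <;> positivity
    rw [← ENNReal.ofReal_prod_of_nonneg fun i _ => by linarith [hh0 i]]
    congr 1
    rw [Fintype.prod_prod_type, Fin.prod_univ_succ]
    simp only [Fin.prod_univ_two, hh, Fin.succ_ne_zero, if_false, if_true, one_ne_zero,
      Finset.prod_const, Finset.card_univ, Fintype.card_fin]
    have e1 : r ^ homDim n = r ^ 2 * (r ^ 2) ^ n := by
      have : homDim n = ((2 + 2 * n : ℕ) : ℝ) := by simp [homDim]; ring
      rw [this, Real.rpow_natCast, pow_add, pow_mul]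
    rw [e1]
    have e2 : (√2 * r - -(√2 * r)) ^ 2 = (2 * √2) * (2 * √2) * r ^ 2 := by ring
    rw [e2, mul_pow]
    ring
  rw [hprod] at hvol
  calc (D : ℝ≥0∞) * volume (Set.Ioo (0 : ℝ) 1 • (Subtype.val '' {η : Sph n | gauge n ζ η ≤ r}))
      ≤ ENNReal.ofReal (D + 1) *
        ENNReal.ofReal (2 * 2 * ((2 * √2) * (2 * √2)) ^ n * r ^ homDim n) := by
        refine mul_le_mul' ?_ hvol
        rw [← ENNReal.ofReal_natCast]
        exact ENNReal.ofReal_le_ofReal (by linarith)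
    _ = _ := by
        rw [← ENNReal.ofReal_mul (by positivity)]
        congr 1
        ring

/-- Conversely the cone contains such a box, with radial coordinate in `[1/2, 3/4]` to keep the norm
inside `(0, 1)`. The size `a` is small enough that the squares of all other coordinates add up to at
most `a r² / 2`. -/
lemma ofReal_le_toSphere_gauge_ball (n : ℕ) : ∃ c : ℝ, 0 < c ∧ ∀ (ζ : Sph n) (r : ℝ), 0 < r →
    r ≤ 1 → ENNReal.ofReal (c * r ^ homDim n) ≤
      (volume : Measure (Amb n)).toSphere {η | gauge n ζ η ≤ r} := by
  set a : ℝ := 1 / (4 * (n + 1)) with ha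
  have ha0 : 0 < a := by positivity
  have ha1 : a * (4 * (n + 1)) = 1 := by rw [ha]; field_simp
  have ha4 : a ≤ 1 / 4 := by
    have : (0 : ℝ) ≤ n := n.cast_nonneg
    nlinarith
  have ha2 : a ^ 2 * (1 + 2 * n) ≤ a / 2 := by
    have : (0 : ℝ) ≤ n := n.cast_nonneg
    nlinarith
  refine ⟨1 / 4 * (2 * a) * (4 * a ^ 2) ^ n, by positivity, fun ζ r hr hr1 => ?_⟩
  obtain ⟨b, hb⟩ := exists_basis_zero_eq ζ
  rw [Measure.toSphere_apply' _ (measurableSet_gauge_le n ζ r)]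
  set l : Fin (n + 1) × Fin 2 → ℝ :=
    fun i => if i.1 = 0 then (if i.2 = 0 then 1 / 2 else -(a * r ^ 2)) else -(a * r) with hl
  set h : Fin (n + 1) × Fin 2 → ℝ :=
    fun i => if i.1 = 0 then (if i.2 = 0 then 3 / 4 else a * r ^ 2) else a * r with hh
  have hsub : {x : Amb n | ∀ i, inner ℝ (realBasis b i) x ∈ Set.Icc (l i) (h i)} ⊆
      Set.Ioo (0 : ℝ) 1 • (Subtype.val '' {η : Sph n | gauge n ζ η ≤ r}) := by
    intro x hx
    have h00 := hx (0, 0)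
    have h01 := hx (0, 1)
    have hj0 : ∀ j : Fin n, |(inner ℂ (b j.succ) x).re| ≤ a * r := fun j => by
      have := hx (j.succ, 0)
      rw [realBasis_apply, inner_realFamily_zero] at this
      rw [abs_le]
      simpa [hl, hh] using this
    have hj1 : ∀ j : Fin n, |(inner ℂ (b j.succ) x).im| ≤ a * r := fun j => by
      have := hx (j.succ, 1)
      rw [realBasis_apply, inner_realFamily_one] at this
      rw [abs_le]
      simpa [hl, hh] using this
    rw [realBasis_apply, inner_realFamily_zero] at h00
    rw [realBasis_apply, inner_realFamily_one] at h01
    have hns := norm_sq_eq_sum b x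
    set w := inner ℂ (b 0) x with hw
    have hre : 1 / 2 ≤ w.re ∧ w.re ≤ 3 / 4 := by simpa [hl, hh] using h00
    have him : |w.im| ≤ a * r ^ 2 := by rw [abs_le]; simpa [hl, hh] using h01
    set S := ∑ j : Fin n, ((inner ℂ (b j.succ) x).re ^ 2 + (inner ℂ (b j.succ) x).im ^ 2) with hS
    have hS0 : 0 ≤ S := Finset.sum_nonneg fun j _ => by positivity
    have hS1 : S ≤ n * (2 * (a * r) ^ 2) := by
      have : S ≤ ∑ _j : Fin n, (2 * (a * r) ^ 2) := by
        refine Finset.sum_le_sum fun j _ => ?_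
        have h1 := sq_le_sq' (abs_le.1 (hj0 j)).1 (abs_le.1 (hj0 j)).2
        have h2 := sq_le_sq' (abs_le.1 (hj1 j)).1 (abs_le.1 (hj1 j)).2
        linarith
      simpa using this
    have hr2 : r ^ 2 ≤ 1 := by nlinarith
    have hr20 : 0 < r ^ 2 := by positivity
    have him2 : w.im ^ 2 ≤ a ^ 2 * r ^ 2 := by
      have h1 := sq_le_sq' (abs_le.1 him).1 (abs_le.1 him).2
      have : (a * r ^ 2) ^ 2 ≤ a ^ 2 * r ^ 2 := by
        rw [mul_pow]
        have : (r ^ 2) ^ 2 ≤ r ^ 2 := by nlinarith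
        gcongr
      linarith
    have hsum : w.im ^ 2 + S ≤ a / 2 * r ^ 2 := by
      have : w.im ^ 2 + S ≤ a ^ 2 * (1 + 2 * n) * r ^ 2 := by nlinarith
      exact this.trans (by gcongr)
    have hN0 : 0 ≤ ‖x‖ := norm_nonneg x
    have hNre : w.re ≤ ‖x‖ := (le_abs_self _).trans
      (abs_le_of_sq_le_sq (by linarith [sq_nonneg w.im]) hN0)
    have hNpos : 0 < ‖x‖ := by linarith [hre.1]
    have hN1 : ‖x‖ < 1 := by
      have : ‖x‖ ^ 2 < 1 := by nlinarith [hre.1, hre.2]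
      nlinarith
    -- The factor `‖x‖ + w.re` is at least `1`, so the difference inherits the bound on the sum of
    -- squares.
    have hdiff : ‖x‖ - w.re ≤ a / 2 * r ^ 2 := by
      have : (‖x‖ - w.re) * (‖x‖ + w.re) = w.im ^ 2 + S := by linear_combination hns
      nlinarith [hre.1]
    have hηs : ‖x‖⁻¹ • x ∈ sphere (0 : Amb n) 1 := by
      simp [norm_smul, hNpos.ne']
    refine Set.mem_smul.2 ⟨‖x‖, ⟨hNpos, hN1⟩, ‖x‖⁻¹ • x, ⟨⟨‖x‖⁻¹ • x, hηs⟩, ?_, rfl⟩, ?_⟩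
    · rw [Set.mem_ofPred_eq, gauge_le_iff n _ _ hr.le]
      simp only
      have e1 : (‖x‖⁻¹ • x : Amb n) = ((‖x‖⁻¹ : ℝ) : ℂ) • x := (Complex.coe_smul _ _).symm
      rw [e1, inner_smul_right, ← hb, ← hw]
      have e2 : 1 - ((‖x‖⁻¹ : ℝ) : ℂ) * w = ((‖x‖⁻¹ : ℝ) : ℂ) * ((‖x‖ : ℂ) - w) := by
        have : (‖x‖ : ℂ) ≠ 0 := by exact_mod_cast hNpos.ne'
        push_cast
        field_simp
      rw [e2, norm_mul, Complex.norm_real, Real.norm_of_nonneg (by positivity),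
        inv_mul_le_iff₀ hNpos]
      have h3 := Complex.norm_le_abs_re_add_abs_im ((‖x‖ : ℂ) - w)
      simp only [Complex.sub_re, Complex.sub_im, Complex.ofReal_re, Complex.ofReal_im, zero_sub,
        abs_neg] at h3
      rw [abs_of_nonneg (by linarith)] at h3
      nlinarith [hre.1]
    · rw [smul_smul, mul_inv_cancel₀ hNpos.ne', one_smul]
  have hvol := measure_mono (μ := volume) hsub
  rw [volume_box] at hvol
  have hprod : ∏ i, ENNReal.ofReal (h i - l i) =
      ENNReal.ofReal (1 / 4 * (2 * a) * (4 * a ^ 2) ^ n * r ^ homDim n) := by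
    have hh0 : ∀ i, 0 ≤ h i - l i := fun i => by
      simp only [hh, hl]; split_ifs
      · norm_num
      · nlinarith [sq_nonneg r]
      · nlinarith
    rw [← ENNReal.ofReal_prod_of_nonneg fun i _ => hh0 i]
    congr 1
    rw [Fintype.prod_prod_type, Fin.prod_univ_succ]
    simp only [Fin.prod_univ_two, hh, hl, Fin.succ_ne_zero, if_false, if_true, one_ne_zero,
      Finset.prod_const, Finset.card_univ, Fintype.card_fin]
    have e1 : r ^ homDim n = r ^ 2 * (r ^ 2) ^ n := by
      have : homDim n = ((2 + 2 * n : ℕ) : ℝ) := by simp [homDim]; ring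
      rw [this, Real.rpow_natCast, pow_add, pow_mul]
    have e2 : (a * r - -(a * r)) ^ 2 = 4 * a ^ 2 * r ^ 2 := by ring
    rw [e1, e2, mul_pow]
    ring
  rw [hprod] at hvol
  refine hvol.trans (le_mul_of_one_le_left' ?_)
  have : 1 ≤ Module.finrank ℝ (Amb n) := Module.finrank_pos
  exact_mod_cast this

/-! ### The contact volume form and its density -/

lemma contactForm_apply (n : ℕ) (z : Amb n) (v : Fin 1 → Amb n) :
    contactForm n z v = (inner ℂ z (v 0)).im := rfl

lemma inner_im_eq_neg {n : ℕ} (u w : Amb n) : (inner ℂ u w).im = -(inner ℂ w u).im :=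
  inner_im_symm (𝕜 := ℂ) u w

lemma inner_re_comm {n : ℕ} (u w : Amb n) : (inner ℂ u w).re = (inner ℂ w u).re :=
  inner_re_symm (𝕜 := ℂ) u w

lemma differentiable_contactForm (n : ℕ) : Differentiable ℝ (contactForm n) := by
  have h : IsLinearMap ℝ (contactForm n) :=
    { map_add := fun x y => by
        ext v
        simp [contactForm_apply]
      map_smul := fun c x => by
        ext v
        have : (c • x : Amb n) = (c : ℂ) • x := (Complex.coe_smul _ _).symm
        rw [this]
        simp [contactForm_apply] }
  exact (LinearMap.toContinuousLinearMap (IsLinearMap.mk' _ h)).differentiable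

lemma fderiv_im_inner (n : ℕ) (z w h : Amb n) :
    fderiv ℝ (fun x : Amb n => (inner ℂ x w).im) z h = (inner ℂ h w).im := by
  have e : (fun x : Amb n => (inner ℂ x w).im) =
      fun x => -((Complex.imCLM.comp ((innerSL ℂ w).restrictScalars ℝ)) x) := by
    ext x
    rw [inner_im_eq_neg]
    rfl
  rw [e, fderiv_fun_neg, ContinuousLinearMap.fderiv]
  rw [inner_im_eq_neg]
  rfl

lemma extDeriv_contactForm_apply (n : ℕ) (z : Amb n) (v : Fin 2 → Amb n) :
    extDeriv (contactForm n) z v = 2 * (inner ℂ (v 0) (v 1)).im := by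
  rw [extDeriv_apply (differentiable_contactForm n z), Fin.sum_univ_two]
  simp only [contactForm_apply, fderiv_im_inner]
  have h0 : (0 : Fin 2).removeNth v 0 = v 1 := rfl
  have h1 : (1 : Fin 2).removeNth v 0 = v 0 := rfl
  rw [h0, h1, inner_im_eq_neg (v 1)]
  simp
  ring

/-- The bilinear form `2 ∑ⱼ xⱼ ⊗ yⱼ` in the real coordinates of a unitary basis. Its
alternatization is `dθ₀`. -/
def coordForm {n : ℕ} (b : OrthonormalBasis (Fin (n + 1)) ℂ (Amb n)) :
    MultilinearMap ℝ (fun _ : Fin 2 => Amb n) ℝ :=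
  ∑ j, (2 : ℝ) • (MultilinearMap.mkPiAlgebra ℝ (Fin 2) ℝ).compLinearMap
    fun e => (innerSL ℝ (realFamily b (j, e))).toLinearMap

lemma coordForm_apply {n : ℕ} (b : OrthonormalBasis (Fin (n + 1)) ℂ (Amb n)) (v : Fin 2 → Amb n) :
    coordForm b v = ∑ j, 2 * (inner ℝ (realFamily b (j, 0)) (v 0) *
      inner ℝ (realFamily b (j, 1)) (v 1)) := by
  simp [coordForm, Fin.prod_univ_two]

lemma sum_perm_fin_two {M : Type*} [AddCommMonoid M] (f : Equiv.Perm (Fin 2) → M) :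
    ∑ σ, f σ = f 1 + f (Equiv.swap 0 1) := by
  have h : (Finset.univ : Finset (Equiv.Perm (Fin 2))) = {1, Equiv.swap 0 1} := by decide
  rw [h, Finset.sum_pair (by decide)]

lemma alternatization_coordForm {n : ℕ} (b : OrthonormalBasis (Fin (n + 1)) ℂ (Amb n))
    (z : Amb n) : MultilinearMap.alternatization (coordForm b) =
      (extDeriv (contactForm n) z).toAlternatingMap := by
  ext v
  change _ = extDeriv (contactForm n) z v
  rw [extDeriv_contactForm_apply, MultilinearMap.alternatization_apply, sum_perm_fin_two,
    ← b.sum_inner_mul_inner, Complex.im_sum, Finset.mul_sum]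
  simp only [MultilinearMap.domDomCongr_apply, coordForm_apply, Equiv.Perm.sign_one, one_smul,
    Equiv.Perm.sign_swap (show (0 : Fin 2) ≠ 1 by decide), Equiv.Perm.one_apply,
    Equiv.swap_apply_left, Equiv.swap_apply_right, inner_realFamily_zero, inner_realFamily_one,
    Units.neg_smul, ← Finset.sum_neg_distrib, ← Finset.sum_add_distrib]
  refine Finset.sum_congr rfl fun j _ => ?_
  rw [Complex.mul_im, inner_im_eq_neg (v 0) (b j), inner_re_comm (v 0) (b j)]
  ring

lemma alternatization_domDomCongr {ι ι' E : Type*} [Fintype ι] [DecidableEq ι] [Fintype ι']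
    [DecidableEq ι'] [AddCommGroup E] [Module ℝ E] (e : ι ≃ ι')
    (m : MultilinearMap ℝ (fun _ : ι => E) ℝ) :
    MultilinearMap.alternatization (m.domDomCongr e) =
      (MultilinearMap.alternatization m).domDomCongr e := by
  ext v
  rw [AlternatingMap.domDomCongr_apply, MultilinearMap.alternatization_apply,
    MultilinearMap.alternatization_apply]
  refine (Fintype.sum_equiv e.permCongr _ _ fun σ => ?_).symm
  rw [Equiv.Perm.sign_permCongr]
  simp [MultilinearMap.domDomCongr_apply, Equiv.permCongr_apply]

/-- The multilinear map `θ ⊗ β ⊗ ⋯ ⊗ β` with `k` factors `β`. -/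
def tensorForm {E : Type*} [AddCommGroup E] [Module ℝ E]
    (θ : MultilinearMap ℝ (fun _ : Fin 1 => E) ℝ)
    (β : MultilinearMap ℝ (fun _ : Fin 2 => E) ℝ) :
    (k : ℕ) → MultilinearMap ℝ (fun _ : Fin (2 * k + 1) => E) ℝ
  | 0 => θ
  | k + 1 => ((LinearMap.mul' ℝ ℝ).compMultilinearMap
      ((tensorForm θ β k).domCoprod β)).domDomCongr
        (finSumFinEquiv : Fin (2 * k + 1) ⊕ Fin 2 ≃ Fin (2 * k + 1 + 2))

lemma tensorForm_apply {E : Type*} [AddCommGroup E] [Module ℝ E]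
    (θ : MultilinearMap ℝ (fun _ : Fin 1 => E) ℝ) (β : MultilinearMap ℝ (fun _ : Fin 2 => E) ℝ)
    (k : ℕ) (v : Fin (2 * k + 1) → E) :
    tensorForm θ β k v =
      θ (fun _ => v 0) * ∏ l : Fin k, β fun e => v ⟨2 * l + 1 + e, by omega⟩ := by
  induction k with
  | zero =>
    simp only [tensorForm, Finset.univ_eq_empty, Finset.prod_empty, mul_one]
    congr 1
    ext i
    exact congrArg v (Subsingleton.elim (α := Fin 1) i 0)
  | succ k ih =>
    rw [Fin.prod_univ_castSucc, ← mul_assoc]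
    exact congrArg (fun t : ℝ => t * β fun e => v ⟨2 * k + 1 + e, by omega⟩)
      (ih fun i : Fin (2 * k + 1) => v (Fin.castAdd 2 i))

/-- The shuffle product of two alternatizations is the alternatization of the tensor product, with
no factorials. The iterated wedge thus becomes one signed sum over permutations, which can be
estimated term by term. -/
lemma contactWedge_eq {n : ℕ} (b : OrthonormalBasis (Fin (n + 1)) ℂ (Amb n)) (z : Amb n) (k : ℕ) :
    contactWedge n z k = MultilinearMap.alternatization
      (tensorForm (contactForm n z).toAlternatingMap.toMultilinearMap (coordForm b) k) := by
  induction k with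
  | zero =>
    have := AlternatingMap.coe_alternatization (contactForm n z).toAlternatingMap
    simp only [Fintype.card_fin, Nat.factorial_one, one_smul] at this
    exact this.symm
  | succ k ih =>
    have h := alternatization_domDomCongr
      (finSumFinEquiv : Fin (2 * k + 1) ⊕ Fin 2 ≃ Fin (2 * k + 1 + 2))
      ((LinearMap.mul' ℝ ℝ).compMultilinearMap
        ((tensorForm (contactForm n z).toAlternatingMap.toMultilinearMap (coordForm b) k).domCoprod
          (coordForm b)))
    rw [LinearMap.compMultilinearMap_alternatization, MultilinearMap.domCoprod_alternization, ← ih,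
      alternatization_coordForm b z] at h
    exact h.symm

/-- The index of `Fin (2 n + 1)` as a distinguished element followed by `n` pairs. -/
def pairEquiv (n : ℕ) : Option (Fin n × Fin 2) ≃ Fin (2 * n + 1) :=
  Equiv.ofBijective
    (fun o => o.elim 0 fun i => ⟨2 * (i.1 : ℕ) + 1 + (i.2 : ℕ), by omega⟩) (by
      rw [Fintype.bijective_iff_injective_and_card]
      refine ⟨?_, by simp [mul_comm]⟩
      rintro (_ | ⟨l, e⟩) (_ | ⟨l', e'⟩) h
      · rfl
      · have h' : 0 = 2 * (l' : ℕ) + 1 + (e' : ℕ) := congrArg Fin.val h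
        omega
      · have h' : 2 * (l : ℕ) + 1 + (e : ℕ) = 0 := congrArg Fin.val h
        omega
      · simp only [Option.elim_some, Fin.mk.injEq] at h
        have h1 : (l : ℕ) = l' := by omega
        have h2 : (e : ℕ) = e' := by omega
        rw [Fin.ext h1, Fin.ext h2])

lemma pairEquiv_none (n : ℕ) : pairEquiv n none = 0 := rfl

lemma pairEquiv_some (n : ℕ) (l : Fin n) (e : Fin 2) :
    pairEquiv n (some (l, e)) = ⟨2 * (l : ℕ) + 1 + (e : ℕ), by omega⟩ := rfl

/-- The indices of the real coordinates tangent to the sphere at the first basis vector. -/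
def tangentIndex (n : ℕ) (o : Option (Fin n × Fin 2)) : Fin (n + 1) × Fin 2 :=
  o.elim (0, 1) fun i => (i.1.succ, i.2)

lemma tangentIndex_injective (n : ℕ) : Function.Injective (tangentIndex n) := by
  rintro (_ | ⟨l, e⟩) (_ | ⟨l', e'⟩) h
  · rfl
  · simp [tangentIndex, (Fin.succ_ne_zero _).symm] at h
  · simp [tangentIndex] at h
  · simp [tangentIndex] at h
    simp [h]

lemma tangentIndex_ne (n : ℕ) (o : Option (Fin n × Fin 2)) : tangentIndex n o ≠ (0, 0) := by
  rcases o with _ | ⟨l, e⟩ <;> simp [tangentIndex]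

/-- A real orthonormal basis of the tangent space of the sphere at the first basis vector. -/
def tangentFrame {n : ℕ} (b : OrthonormalBasis (Fin (n + 1)) ℂ (Amb n)) (i : Fin (2 * n + 1)) :
    Amb n :=
  realFamily b (tangentIndex n ((pairEquiv n).symm i))

lemma orthonormal_tangentFrame {n : ℕ} (b : OrthonormalBasis (Fin (n + 1)) ℂ (Amb n)) :
    Orthonormal ℝ (tangentFrame b) :=
  (orthonormal_realFamily b).comp (fun i => tangentIndex n ((pairEquiv n).symm i))
    ((tangentIndex_injective n).comp (pairEquiv n).symm.injective)

lemma realFamily_zero_zero {n : ℕ} (b : OrthonormalBasis (Fin (n + 1)) ℂ (Amb n)) :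
    realFamily b (0, 0) = b 0 := by
  simp [realFamily]

lemma inner_tangentFrame {n : ℕ} (b : OrthonormalBasis (Fin (n + 1)) ℂ (Amb n))
    (i : Fin (2 * n + 1)) : inner ℝ (b 0) (tangentFrame b i) = 0 := by
  rw [← realFamily_zero_zero b]
  exact (orthonormal_realFamily b).2 (tangentIndex_ne n _).symm

lemma contactForm_realFamily {n : ℕ} (b : OrthonormalBasis (Fin (n + 1)) ℂ (Amb n))
    (i : Fin (n + 1) × Fin 2) :
    contactForm n (b 0) (fun _ => realFamily b i) = if i = (0, 1) then 1 else 0 := by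
  rw [contactForm_apply, ← inner_realFamily_one,
    orthonormal_iff_ite.1 (orthonormal_realFamily b)]
  simp only [eq_comm]

lemma coordForm_realFamily {n : ℕ} (b : OrthonormalBasis (Fin (n + 1)) ℂ (Amb n))
    (i : Fin 2 → Fin (n + 1) × Fin 2) :
    coordForm b (fun e => realFamily b (i e)) =
      if (i 0).2 = 0 ∧ i 1 = ((i 0).1, 1) then 2 else 0 := by
  rw [coordForm_apply]
  simp only [orthonormal_iff_ite.1 (orthonormal_realFamily b)]
  obtain ⟨j, e⟩ := i 0
  obtain ⟨k, f⟩ := i 1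
  have hterm : ∀ x : Fin (n + 1), (2 : ℝ) * ((if (x, (0 : Fin 2)) = (j, e) then 1 else 0) *
      if (x, (1 : Fin 2)) = (k, f) then 1 else 0) =
        if j = x then (if e = 0 ∧ (k, f) = (j, 1) then 2 else 0) else 0 := fun x => by
    simp only [Prod.mk.injEq]
    by_cases h1 : j = x
    · subst h1
      by_cases h2 : e = 0 <;> by_cases h3 : k = j <;> by_cases h4 : f = 1 <;>
        simp [h2, h3, h4, eq_comm (a := j) (b := k), eq_comm (a := (0 : Fin 2)) (b := e),
          eq_comm (a := (1 : Fin 2)) (b := f)]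
    · simp [h1, Ne.symm h1]
  rw [Finset.sum_congr rfl fun x _ => hterm x, Finset.sum_ite_eq]
  simp

/-- `τ` acts by the same permutation `ρ` on the first and on the second members of the pairs, so its
sign is a square. -/
lemma sign_eq_one_of_preserves_pairs {n : ℕ} (τ : Equiv.Perm (Option (Fin n × Fin 2)))
    (h0 : τ none = none)
    (h : ∀ l, ∃ k, τ (some (l, 0)) = some (k, 0) ∧ τ (some (l, 1)) = some (k, 1)) :
    Equiv.Perm.sign τ = 1 := by
  choose ρ hρ0 hρ1 using h
  have hinj : Function.Injective ρ := fun l l' hl => by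
    have : τ (some (l, 0)) = τ (some (l', 0)) := by rw [hρ0, hρ0, hl]
    simpa using τ.injective this
  set ρ' : Equiv.Perm (Fin n) := Equiv.ofBijective ρ (Finite.injective_iff_bijective.1 hinj)
  have hτ : τ = Equiv.optionCongr (Equiv.prodCongrLeft fun _ : Fin 2 => ρ') := by
    ext1 o
    rcases o with _ | ⟨l, e⟩
    · simpa using h0
    · fin_cases e
      · exact hρ0 l
      · exact hρ1 l
  rw [hτ, Equiv.optionCongr_sign, Equiv.Perm.sign_prodCongrLeft, Fin.prod_univ_two,
    Int.units_mul_self]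

/-- No cancellation occurs: a permutation with nonzero term fixes the distinguished index and maps
pairs to pairs in order, hence is even. The identity alone contributes `2 ^ n`. -/
lemma one_le_contactWedge_tangentFrame {n : ℕ} (b : OrthonormalBasis (Fin (n + 1)) ℂ (Amb n)) :
    1 ≤ contactWedge n (b 0) n (tangentFrame b) := by
  set T := tensorForm (contactForm n (b 0)).toAlternatingMap.toMultilinearMap (coordForm b) n
    with hT
  have hv : tangentFrame b =
      (fun o => realFamily b (tangentIndex n o)) ∘ (pairEquiv n).symm := rfl
  rw [contactWedge_eq b, hv, ← AlternatingMap.domDomCongr_apply, ← alternatization_domDomCongr,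
    MultilinearMap.alternatization_apply]
  have hterm : ∀ τ : Equiv.Perm (Option (Fin n × Fin 2)),
      (MultilinearMap.domDomCongr τ (MultilinearMap.domDomCongr (pairEquiv n).symm T))
        (fun o => realFamily b (tangentIndex n o)) =
      (if tangentIndex n (τ none) = (0, 1) then 1 else 0) *
        ∏ l : Fin n, if (tangentIndex n (τ (some (l, 0)))).2 = 0 ∧
          tangentIndex n (τ (some (l, 1))) = ((tangentIndex n (τ (some (l, 0)))).1, 1)
            then 2 else 0 := fun τ => by
    rw [MultilinearMap.domDomCongr_apply, MultilinearMap.domDomCongr_apply, hT, tensorForm_apply,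
      ← contactForm_realFamily b]
    congr 1
    · refine congrArg (contactForm n (b 0)) (funext fun _ => ?_)
      rw [← pairEquiv_none, Equiv.symm_apply_apply]
    · refine Finset.prod_congr rfl fun l _ => ?_
      rw [← coordForm_realFamily b fun e => tangentIndex n (τ (some (l, e)))]
      refine congrArg (coordForm b) (funext fun e => ?_)
      rw [← pairEquiv_some, Equiv.symm_apply_apply]
  have hnonneg : ∀ τ : Equiv.Perm (Option (Fin n × Fin 2)), 0 ≤ Equiv.Perm.sign τ •
      (MultilinearMap.domDomCongr τ (MultilinearMap.domDomCongr (pairEquiv n).symm T))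
        (fun o => realFamily b (tangentIndex n o)) := fun τ => by
    rw [hterm]
    have hpos : (0 : ℝ) ≤ (if tangentIndex n (τ none) = (0, 1) then 1 else 0) *
        ∏ l : Fin n, if (tangentIndex n (τ (some (l, 0)))).2 = 0 ∧
          tangentIndex n (τ (some (l, 1))) = ((tangentIndex n (τ (some (l, 0)))).1, 1)
            then 2 else 0 :=
      mul_nonneg (by split_ifs <;> norm_num)
        (Finset.prod_nonneg fun l _ => by split_ifs <;> norm_num)
    by_cases h0 : tangentIndex n (τ none) = (0, 1)
    · by_cases h : ∀ l : Fin n, (tangentIndex n (τ (some (l, 0)))).2 = 0 ∧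
          tangentIndex n (τ (some (l, 1))) = ((tangentIndex n (τ (some (l, 0)))).1, 1)
      · have hnone : τ none = none := tangentIndex_injective n h0
        rw [sign_eq_one_of_preserves_pairs τ hnone, one_smul]
        · exact hpos
        · intro l
          obtain ⟨h1, h2⟩ := h l
          rcases hτ : τ (some (l, 0)) with _ | ⟨k, e⟩
          · exact absurd (τ.injective (hτ.trans hnone.symm)) (by simp)
          · rw [hτ] at h1 h2
            have he : e = 0 := h1
            subst he
            exact ⟨k, rfl, tangentIndex_injective n h2⟩
      · push Not at h
        obtain ⟨l, hl⟩ := h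
        rw [Finset.prod_eq_zero (Finset.mem_univ l) (if_neg fun hh => hl hh.1 hh.2)]
        simp
    · rw [if_neg h0]; simp
  refine le_trans ?_ (Finset.single_le_sum (fun τ _ => hnonneg τ) (Finset.mem_univ 1))
  rw [hterm]
  simp [tangentIndex]
  exact one_le_pow₀ (by norm_num)

/-- A crude count suffices, as only a bound uniform in `ζ` is needed: `(2n + 1)!` permutations, and
in each term `n` factors that are sums of `n + 1` numbers of size at most `2`. -/
lemma abs_contactWedge_le {n : ℕ} (ζ : Sph n) :
    ∀ v : Fin (2 * n + 1) → Amb n, (∀ i, ‖v i‖ = 1) →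
      |contactWedge n ζ n v| ≤ (2 * n + 1).factorial * (2 * (n + 1)) ^ n := by
  intro v hv
  obtain ⟨b, hb⟩ := exists_basis_zero_eq ζ
  rw [contactWedge_eq b, MultilinearMap.alternatization_apply]
  refine (Finset.abs_sum_le_sum_abs _ _).trans ?_
  have hle : ∀ σ : Equiv.Perm (Fin (2 * n + 1)), |Equiv.Perm.sign σ •
      (MultilinearMap.domDomCongr σ
        (tensorForm (contactForm n ζ).toAlternatingMap.toMultilinearMap (coordForm b) n)) v| ≤
      (2 * (n + 1)) ^ n := fun σ => by
    have habs : ∀ (ε : ℤˣ) (x : ℝ), |ε • x| = |x| := fun ε x => by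
      rcases Int.units_eq_one_or ε with h | h <;> simp [h]
    rw [habs, MultilinearMap.domDomCongr_apply, tensorForm_apply, abs_mul, Finset.abs_prod]
    have h1 : |contactForm n ζ (fun _ => v (σ 0))| ≤ 1 := by
      rw [contactForm_apply]
      refine (Complex.abs_im_le_norm _).trans ((norm_inner_le_norm _ _).trans ?_)
      simp [hv]
    have hone : ∀ (i : Fin (n + 1) × Fin 2) (k : Fin (2 * n + 1)),
        |inner ℝ (realFamily b i) (v k)| ≤ 1 := fun i k => by
      refine (abs_real_inner_le_norm _ _).trans ?_
      rw [hv, (orthonormal_realFamily b).1 i, one_mul]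
    have h2 : ∀ l : Fin n, |coordForm b fun e => v (σ ⟨2 * (l : ℕ) + 1 + (e : ℕ), by omega⟩)| ≤
        2 * (n + 1) := fun l => by
      rw [coordForm_apply]
      refine (Finset.abs_sum_le_sum_abs _ _).trans ?_
      have : ∀ j : Fin (n + 1), |2 * (inner ℝ (realFamily b (j, 0))
          (v (σ ⟨2 * (l : ℕ) + 1 + ((0 : Fin 2) : ℕ), by omega⟩)) *
          inner ℝ (realFamily b (j, 1))
          (v (σ ⟨2 * (l : ℕ) + 1 + ((1 : Fin 2) : ℕ), by omega⟩)))| ≤ 2 := fun j => by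
        rw [abs_mul, abs_mul, abs_two]
        have := mul_le_one₀ (hone (j, 0) (σ ⟨2 * (l : ℕ) + 1 + ((0 : Fin 2) : ℕ), by omega⟩))
          (abs_nonneg _) (hone (j, 1) (σ ⟨2 * (l : ℕ) + 1 + ((1 : Fin 2) : ℕ), by omega⟩))
        linarith
      refine (Finset.sum_le_sum fun j _ => this j).trans (le_of_eq ?_)
      simp
      ring
    have h3 : ∏ l : Fin n, |coordForm b fun e => v (σ ⟨2 * (l : ℕ) + 1 + (e : ℕ), by omega⟩)| ≤
        (2 * (n + 1)) ^ n := by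
      refine (Finset.prod_le_prod (fun _ _ => abs_nonneg _) fun l _ => h2 l).trans (le_of_eq ?_)
      simp
    have h4 := mul_le_mul h1 h3 (Finset.prod_nonneg fun _ _ => abs_nonneg _) zero_le_one
    simpa using h4
  refine (Finset.sum_le_sum fun σ _ => hle σ).trans (le_of_eq ?_)
  simp [Fintype.card_perm]

lemma one_le_volumeDensity (n : ℕ) (ζ : Sph n) : 1 ≤ volumeDensity n ζ := by
  obtain ⟨b, hb⟩ := exists_basis_zero_eq ζ
  refine le_iSup_of_le (tangentFrame b) (le_iSup_of_le (orthonormal_tangentFrame b)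
    (le_iSup_of_le (fun i => by rw [← hb]; exact inner_tangentFrame b i) ?_))
  have h := one_le_contactWedge_tangentFrame b
  rw [hb] at h
  rw [Real.enorm_eq_ofReal (by linarith), ← ENNReal.ofReal_one]
  exact ENNReal.ofReal_le_ofReal h

lemma volumeDensity_le (n : ℕ) (ζ : Sph n) :
    volumeDensity n ζ ≤ ENNReal.ofReal ((2 * n + 1).factorial * (2 * (n + 1)) ^ n) := by
  refine iSup_le fun v => iSup_le fun hv => iSup_le fun _ => ?_
  rw [Real.enorm_eq_ofReal_abs]
  exact ENNReal.ofReal_le_ofReal (abs_contactWedge_le ζ v hv.1)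

/-! ### Volume regularity of CR distances -/

lemma toSphere_le_vol (n : ℕ) (s : Set (Sph n)) :
    (volume : Measure (Amb n)).toSphere s ≤ vol n s := by
  have h := withDensity_mono (μ := (volume : Measure (Amb n)).toSphere) (f := fun _ => 1)
    (g := volumeDensity n) (Eventually.of_forall fun ζ => one_le_volumeDensity n ζ)
  rw [withDensity_const, one_smul] at h
  exact h s

lemma vol_le_toSphere (n : ℕ) (s : Set (Sph n)) :
    vol n s ≤ ENNReal.ofReal ((2 * n + 1).factorial * (2 * (n + 1)) ^ n) *
      (volume : Measure (Amb n)).toSphere s := by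
  have h := withDensity_mono (μ := (volume : Measure (Amb n)).toSphere) (f := volumeDensity n)
    (g := fun _ => ENNReal.ofReal ((2 * n + 1).factorial * (2 * (n + 1)) ^ n))
    (Eventually.of_forall fun ζ => volumeDensity_le n ζ)
  rw [withDensity_const] at h
  exact h s

instance isFiniteMeasure_vol (n : ℕ) : IsFiniteMeasure (vol n) :=
  ⟨(vol_le_toSphere n _).trans_lt (ENNReal.mul_lt_top ENNReal.ofReal_lt_top (measure_lt_top _ _))⟩

lemma omega_pos (n : ℕ) : 0 < (vol n).real Set.univ := by
  rw [Measure.real, ENNReal.toReal_pos_iff]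
  refine ⟨?_, measure_lt_top _ _⟩
  refine lt_of_lt_of_le ?_ (toSphere_le_vol n Set.univ)
  rw [pos_iff_ne_zero, Ne, Measure.measure_univ_eq_zero]
  exact Measure.toSphere_ne_zero _

lemma IsCRDistance.nonneg {n : ℕ} {d : Sph n → Sph n → ℝ} (hd : IsCRDistance n d) (ζ η : Sph n) :
    0 ≤ d ζ η := by
  obtain ⟨c, C, hc, hC, h⟩ := hd.equivalent
  exact (mul_nonneg hc.le (gauge_nonneg n ζ η)).trans (h ζ η).1

/-- The triangle inequality gives continuity: `d ζ` varies by at most `d η₀ η`, which is dominated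
by the continuous gauge. -/
lemma IsCRDistance.measurable {n : ℕ} {d : Sph n → Sph n → ℝ} (hd : IsCRDistance n d) (ζ : Sph n) :
    Measurable (d ζ) := by
  obtain ⟨c, C, hc, hC, h⟩ := hd.equivalent
  refine Continuous.measurable (continuous_iff_continuousAt.2 fun η₀ => ?_)
  rw [ContinuousAt, tendsto_iff_dist_tendsto_zero]
  have hg : Tendsto (fun η => C * gauge n η₀ η) (𝓝 η₀) (𝓝 0) := by
    have := ((continuous_gauge_right n η₀).tendsto η₀).const_mul C
    have h0 : gauge n η₀ η₀ = 0 := by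
      have h1 := (h η₀ η₀).1
      rw [(hd.eq_zero_iff η₀ η₀).2 rfl] at h1
      exact le_antisymm (nonpos_of_mul_nonpos_right h1 hc) (gauge_nonneg n _ _)
    rwa [h0, mul_zero] at this
  refine squeeze_zero (fun _ => dist_nonneg) (fun η => ?_) hg
  refine le_trans ?_ (h η₀ η).2
  rw [Real.dist_eq, abs_le]
  have h1 := hd.triangle ζ η₀ η
  have h2 := hd.triangle ζ η η₀
  rw [hd.symm η η₀] at h2
  constructor <;> linarith

lemma IsCRDistance.exists_regular {n : ℕ} {d : Sph n → Sph n → ℝ} (hd : IsCRDistance n d) :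
    ∃ R c C L : ℝ, LowerRegular (vol n) d (homDim n) R c ∧
      (∀ ζ r, 0 < r → r ≤ R → vol n {η | d ζ η ≤ r} ≤ ENNReal.ofReal (C * r ^ homDim n)) ∧
      0 ≤ L ∧ ∀ ζ η, gauge n ζ η ≤ L * d ζ η := by
  obtain ⟨c, C, hc, hC, h⟩ := hd.equivalent
  obtain ⟨a, ha, haa⟩ := ofReal_le_toSphere_gauge_ball n
  obtain ⟨A, hA, hAA⟩ := toSphere_gauge_ball_le n
  set D : ℝ := (2 * n + 1).factorial * (2 * (n + 1)) ^ n
  -- The gauge is at most `2`, so `d ≤ 2 C`. The lower ball bound holds for gauge radii up to `1`,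
  -- hence the rescaling by `1 / (2 C)`.
  refine ⟨2 * C, a * (1 / (2 * C)) ^ homDim n, D * (A * (1 / c) ^ homDim n), 1 / c, ?_, ?_,
    by positivity, fun ζ η => ?_⟩
  · refine ⟨hd.measurable, hd.nonneg, fun ζ η => (hd.eq_zero_iff ζ η).1, fun ζ η => ?_,
      by positivity, by positivity, fun ζ r hr hrR => ?_⟩
    · have := gauge_le_two n ζ η
      nlinarith [(h ζ η).2]
    · have h1 := haa ζ (1 / (2 * C) * r) (by positivity) (by
        rw [one_div, inv_mul_le_iff₀ (by positivity)]; linarith)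
      rw [Real.mul_rpow (by positivity) hr.le, ← mul_assoc] at h1
      refine h1.trans ((toSphere_le_vol n _).trans (measure_mono fun η hη => ?_))
      have h2 : gauge n ζ η ≤ 1 / (2 * C) * r := hη
      have h3 : d ζ η ≤ C * (1 / (2 * C) * r) := (h ζ η).2.trans (by gcongr)
      have h4 : C * (1 / (2 * C) * r) = r / 2 := by field_simp
      change d ζ η ≤ r
      linarith
  · intro ζ r hr _
    have h1 := hAA ζ (1 / c * r) (by positivity)
    rw [Real.mul_rpow (by positivity) hr.le, ← mul_assoc] at h1
    rw [mul_assoc, ENNReal.ofReal_mul (by positivity)]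
    refine (vol_le_toSphere n _).trans (mul_le_mul' le_rfl
      (le_trans (measure_mono fun η hη => ?_) h1))
    have h2 : d ζ η ≤ r := hη
    have h3 := (h ζ η).1.trans h2
    change gauge n ζ η ≤ 1 / c * r
    rw [one_div, le_inv_mul_iff₀ hc]
    exact h3
  · rw [one_div, le_inv_mul_iff₀ hc]
    exact (h ζ η).1

/-! ### The test function and the final assembly -/

/-- The test function `Re ζ₀`. -/
def reCoord (n : ℕ) (ζ : Sph n) : ℝ := ((ζ : Amb n) 0).re

/-- On the sphere `|ζ - η|² = 2 Re (1 - ⟨ζ, η⟩)`, which is at most twice the squared gauge. -/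
lemma abs_reCoord_sub_le {n : ℕ} (ζ η : Sph n) :
    |reCoord n ζ - reCoord n η| ≤ 2 * gauge n ζ η := by
  have h1 : |reCoord n ζ - reCoord n η| ≤ ‖(ζ : Amb n) - (η : Amb n)‖ :=
    (Complex.abs_re_le_norm (((ζ : Amb n) - (η : Amb n)) 0)).trans
      (PiLp.norm_apply_le ((ζ : Amb n) - (η : Amb n)) 0)
  have h2 := norm_sub_sq (𝕜 := ℂ) (ζ : Amb n) (η : Amb n)
  have hζ : ‖(ζ : Amb n)‖ = 1 := by simp
  have hη : ‖(η : Amb n)‖ = 1 := by simp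
  rw [hζ, hη, RCLike.re_eq_complex_re] at h2
  have h3 := Complex.re_le_norm (1 - inner ℂ (ζ : Amb n) (η : Amb n))
  rw [Complex.sub_re, Complex.one_re] at h3
  have h4 := gauge_sq n ζ η
  have h5 := gauge_nonneg n ζ η
  refine h1.trans ((le_abs_self _).trans (abs_le_of_sq_le_sq ?_ (by positivity)))
  rw [h2, mul_pow, h4]
  linarith [norm_nonneg (1 - inner ℂ (ζ : Amb n) (η : Amb n))]

lemma measurable_reCoord (n : ℕ) : Measurable (reCoord n) := by
  refine Continuous.measurable ?_
  unfold reCoord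
  fun_prop

lemma abs_reCoord_le {n : ℕ} (ζ : Sph n) : |reCoord n ζ| ≤ 1 := by
  refine (Complex.abs_re_le_norm _).trans ((PiLp.norm_apply_le (ζ : Amb n) 0).trans ?_)
  simp

/-- Gauge balls have positive measure, so an a.e. constant value would lie within `1/2` of every
value, including `1` and `-1`. -/
lemma reCoord_not_ae_const (n : ℕ) (m : ℝ) : ¬ reCoord n =ᵐ[vol n] fun _ => m := by
  intro h
  have key : ∀ ξ : Sph n, |reCoord n ξ - m| ≤ 1 / 2 := fun ξ => by
    obtain ⟨a, ha, haa⟩ := ofReal_le_toSphere_gauge_ball n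
    have hpos : vol n {η | gauge n ξ η ≤ 1 / 4} ≠ 0 := by
      refine (lt_of_lt_of_le ?_ ((haa ξ (1 / 4) (by norm_num) (by norm_num)).trans
        (toSphere_le_vol n _))).ne'
      rw [ENNReal.ofReal_pos]
      positivity
    obtain ⟨η, hη, hm⟩ := ((frequently_ae_iff.2 hpos).and_eventually h).exists
    have h1 := abs_reCoord_sub_le ξ η
    rw [hm] at h1
    linarith
  have hs : ‖(EuclideanSpace.single 0 1 : Amb n)‖ = 1 := by simp
  have h1 := key ⟨EuclideanSpace.single 0 1, by simp⟩
  have h2 := key ⟨-EuclideanSpace.single 0 1, by simp⟩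
  simp only [reCoord, PiLp.neg_apply, PiLp.single_apply, if_true, Complex.neg_re,
    Complex.one_re] at h1 h2
  have h3 := abs_le.1 h1
  have h4 := abs_le.1 h2
  linarith [h3.2, h4.1]

lemma mem_admissibleBhat_iff {n : ℕ} {d : Sph n → Sph n → ℝ} {s p κ : ℝ} (hp : 0 < p) (hκ : 0 < κ)
    (hq : critExp n s p = κ * p) (B : ℝ) :
    B ∈ admissibleBhat n d s p ↔ Admissible (vol n) d p κ (homDim n + s * p) B := by
  have hexp : p / (κ * p) = 1 / κ := by field_simp
  have hpp : p / p = 1 := div_self hp.ne'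
  have hform : ∀ (A : ℝ) (u : Sph n → ℝ), AEStronglyMeasurable u (vol n) →
      (lpNorm n (critExp n s p) u ^ p ≤ A * (seminormPow n d s p u).toReal + B * lpNorm n p u ^ p ↔
      (∫ x, |u x| ^ (κ * p) ∂vol n) ^ (1 / κ) ≤
        A * (energy (vol n) d p (homDim n + s * p) u).toReal + B * ∫ x, |u x| ^ p ∂vol n) := by
    intro A u hu
    rw [lpNorm, lpNorm, toReal_eLpNorm_rpow (by rw [hq]; positivity) p hu,
      toReal_eLpNorm_rpow hp p hu, hpp, Real.rpow_one, hq, hexp]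
    rfl
  constructor
  · rintro ⟨A, hA⟩
    refine ⟨A, fun u hu hE => ?_⟩
    obtain ⟨h1, h2⟩ := hA u ⟨hu, lt_top_iff_ne_top.2 hE⟩
    exact ⟨hq ▸ h1, (hform A u hu.1).1 h2⟩
  · rintro ⟨A, hA⟩
    refine ⟨A, fun u hu => ?_⟩
    obtain ⟨h1, h2⟩ := hA u hu.1 hu.2.ne
    exact ⟨hq ▸ h1, (hform A u hu.1.1).2 h2⟩

end

end CRSphere

theorem theorem1p2 (n : ℕ) (hn : 1 ≤ n) (d : CRSphere.Sph n → CRSphere.Sph n → ℝ)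
    (hd : CRSphere.IsCRDistance n d) (s p : ℝ) (hs0 : 0 < s) (hs1 : s < 1)
    (hp1 : 1 < p) (hpQ : p < CRSphere.homDim n) :
    (p ≤ 2 →
      CRSphere.admissibleBhat n d s p
          = Set.Ici (CRSphere.omega n ^ (-(s * p / CRSphere.homDim n))) ∧
        IsClosed (CRSphere.admissibleBhat n d s p) ∧
        IsLeast (CRSphere.admissibleBhat n d s p)
          (CRSphere.omega n ^ (-(s * p / CRSphere.homDim n)))) ∧
    (2 < p →
      CRSphere.admissibleBhat n d s p
          = Set.Ioi (CRSphere.omega n ^ (-(s * p / CRSphere.homDim n))) ∧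
        IsGLB (CRSphere.admissibleBhat n d s p)
          (CRSphere.omega n ^ (-(s * p / CRSphere.homDim n))) ∧
        CRSphere.omega n ^ (-(s * p / CRSphere.homDim n)) ∉ CRSphere.admissibleBhat n d s p ∧
        ¬ IsClosed (CRSphere.admissibleBhat n d s p)) := by
  open CRSphere in
  have hp0 : 0 < p := by linarith
  have hQ : 0 < homDim n := by linarith
  have hsp : 0 < s * p := by positivity
  have hspQ : s * p < homDim n := by nlinarith
  have hsub : 0 < homDim n - s * p := by linarith
  set κ : ℝ := homDim n / (homDim n - s * p) with hκdef
  have hκ : 1 < κ := by rw [hκdef, one_lt_div hsub]; linarith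
  have hκ0 : 0 < κ := by linarith
  have hq : critExp n s p = κ * p := by rw [critExp, hκdef]; ring
  have hσ : s * p = homDim n * (1 - 1 / κ) := by
    rw [hκdef]; field_simp; ring
  have hB : omega n ^ (-(s * p / homDim n)) = (vol n).real Set.univ ^ (1 / κ - 1) := by
    rw [omega]
    congr 1
    rw [hκdef]; field_simp; ring
  have hμ := omega_pos n
  obtain ⟨R, c, C, L, H, hupper, hL, hgauge⟩ := hd.exists_regular
  have hmem := mem_admissibleBhat_iff (n := n) (d := d) hp0 hκ0 hq
  rw [hB]
  refine ⟨fun hp2 => ?_, fun hp2 => ?_⟩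
  · have hset : admissibleBhat n d s p = Set.Ici ((vol n).real Set.univ ^ (1 / κ - 1)) := by
      ext B
      rw [hmem, Set.mem_Ici]
      exact ⟨fun h => h.le hμ hp0,
        fun h => (admissible_of_le_two hμ H hp1 hp2 hQ hκ hσ).mono h⟩
    rw [hset]
    exact ⟨rfl, isClosed_Ici, isLeast_Ici⟩
  · have hE : energy (vol n) d p (homDim n + s * p) (reCoord n) ≠ ∞ := by
      refine energy_ne_top_of_lipschitz (L := 2 * L) H.measurable H.nonneg H.eq_of_eq_zero
        H.pos_radius H.le hupper hp0 (by linarith) ?_ (by linarith) fun ζ η => ?_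
      -- The exponent condition reads `p - s p > 0`, which is where `s < 1` makes the test function
      -- admissible.
      · nlinarith
      · exact (abs_reCoord_sub_le ζ η).trans (by nlinarith [hgauge ζ η])
    have hnot : ¬ Admissible (vol n) d p κ (homDim n + s * p)
        ((vol n).real Set.univ ^ (1 / κ - 1)) :=
      not_admissible_of_two_lt hμ H.nonneg hp2 hκ (measurable_reCoord n) ⟨1, abs_reCoord_le⟩
        (reCoord_not_ae_const n) hE
    have hset : admissibleBhat n d s p = Set.Ioi ((vol n).real Set.univ ^ (1 / κ - 1)) := by
      ext B
      rw [hmem, Set.mem_Ioi]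
      refine ⟨fun h => lt_of_le_of_ne (h.le hμ hp0) fun heq => hnot (heq ▸ h),
        fun h => admissible_of_lt hμ H hp1 hQ hκ hσ h⟩
    rw [hset]
    refine ⟨rfl, isGLB_Ioi, by simp, fun hcl => ?_⟩
    have := hcl.closure_eq
    rw [closure_Ioi] at this
    exact absurd (this ▸ Set.self_mem_Ici : _ ∈ Set.Ioi _) (by simp)
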